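/- Let $\mathbb D$ be the open unit disc of $\mathbb C$ and $dA=\frac{dx\,dy}{\pi}$ the normalized area measure on it. A radial weight is a nonnegative function $\omega\in L^1([0,1))$, extended to $\mathbb D$ by $\omega(z)=\omega(|z|)$, such that $\widehat\omega(r)=\int_r^1\omega(s)\,ds>0$ for all $0\le r<1$; put $\widehat\omega(z)=\widehat\omega(|z|)$ for $z\in\mathbb D$. For a nonnegative measurable function $\mu$ on $[0,1)$ write $\mu_x=\int_0^1 s^x\mu(s)\,ds\in[0,\infty]$, $x\ge 0$. The weight $\omega$ belongs to $\widehat{\mathcal D}$ if there is $C>0$ with $\widehat\omega(r)\le C\,\widehat\omega\left(\frac{1+r}{2}\right)$ for all $r<1$ close enough to $1$. Let $B^\omega_z$, $z\in\mathbb D$, be the reproducing kernels of the weighted Bergman space $A^2_\omega$ of analytic functions $f$ in $\mathbb D$ with $\int_{\mathbb D}|f|^2\omega\,dA<\infty$, and let $$P_\omega(f)(z)=\int_{\mathbb D}f(\zeta)\,\overline{B^\omega_z(\zeta)}\,\omega(\zeta)\,dA(\zeta),\qquad z\in\mathbb D.$$ For a radial weight $\nu$ let $L^\infty_{\widehat\nu}$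 be the space of measurable $f:\mathbb D\to\mathbb C$ with $\|f\|_{\infty,\widehat\nu}=\operatorname{ess\,sup}_{z\in\mathbb D}|f(z)|\widehat\nu(z)<\infty$, and let $\mathcal B^\infty_{\widehat\nu}$ be the space of analytic functions $f$ in $\mathbb D$ with $\|f\|_{\mathcal B^\infty_{\widehat\nu}}=\sup_{z\in\mathbb D}(1-|z|)\widehat\nu(z)|f'(z)|<\infty$. That $P_\omega:L^\infty_{\widehat\nu}\to\mathcal B^\infty_{\widehat\nu}$ is bounded means that for every $f\in L^\infty_{\widehat\nu}$ the integral defining $P_\omega(f)(z)$ converges absolutely for every $z\in\mathbb D$ and $P_\omega(f)\in\mathcal B^\infty_{\widehat\nu}$, and that there is a constant $C$ with $\|P_\omega(f)\|_{\mathcal B^\infty_{\widehat\nu}}\le C\|f\|_{\infty,\widehat\nu}$ for all $f\in L^\infty_{\widehat\nu}$. **Theorem.** Let $\nu$ be a radial weight and $\omega\in\widehat{\mathcal D}$ a radial weight. Then the following conditions are equivalent: (i) $P_\omega:L^\infty_{\widehat\nu}\to\mathcal B^\infty_{\widehat\nu}$ is bounded; (ii) $\displaystyle\sup_{x\ge 0}\frac{\nu_x}{\omega_{2x}}\left(\frac{\omega}{\widehat\nu}\right)_x<\infty$;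 (iii) $\displaystyle\sup_{0\le r<1}\frac{\widehat\nu(r)}{\widehat\omega(r)}\int_r^1\frac{\omega(s)}{\widehat\nu(s)}\,ds<\infty$. -/

import Mathlib

open MeasureTheory Filter Topology
open scoped ENNReal NNReal ComplexConjugate

noncomputable section

namespace BergmanGrowth

/-- The open unit disc of the complex plane. -/
def unitDisc : Set ℂ := Metric.ball (0 : ℂ) 1

/-- The normalized area measure `dA = dx dy / π` on the unit disc. -/
def discArea : Measure ℂ :=
  ENNReal.ofReal (Real.pi⁻¹) • (volume : Measure ℂ).restrict unitDisc

/-- The tail integral `ω̂(r) = ∫_r^1 ω(s) ds`. -/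
def tail (ω : ℝ → ℝ) (r : ℝ) : ℝ := ∫ s in r..1, ω s

/-- A radial weight: a nonnegative integrable function on `[0,1)` whose tail integral is positive
at every point of `[0,1)`. Only the values on `[0,1)` matter; the weight is extended to the disc
by `z ↦ ω ‖z‖`. -/
structure IsRadialWeight (ω : ℝ → ℝ) : Prop where
  nonneg : ∀ r ∈ Set.Ico (0 : ℝ) 1, 0 ≤ ω r
  integrableOn : IntegrableOn ω (Set.Ico (0 : ℝ) 1)
  tail_pos : ∀ r ∈ Set.Ico (0 : ℝ) 1, 0 < tail ω r

/-- The upper doubling condition: `ω̂(r) ≤ C ω̂((1+r)/2)` as `r → 1⁻`. -/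
def UpperDoubling (ω : ℝ → ℝ) : Prop :=
  ∃ C : ℝ, 0 < C ∧ ∀ᶠ r in 𝓝[<] (1 : ℝ), tail ω r ≤ C * tail ω ((1 + r) / 2)

/-- The moment `μ_x = ∫_0^1 s^x μ(s) ds` of a nonnegative function, as a value in `[0,∞]`. -/
def moment (μ : ℝ → ℝ) (x : ℝ) : ℝ≥0∞ :=
  ∫⁻ s in Set.Ico (0 : ℝ) 1, ENNReal.ofReal (s ^ x * μ s)

/-- The weighted Bergman space `A²_ω`: analytic functions `f` in the disc such that
`∫ |f|² ω dA < ∞`. -/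
def bergmanSpace (ω : ℝ → ℝ) : Set (ℂ → ℂ) :=
  {f | AnalyticOnNhd ℂ f unitDisc ∧
    (∫⁻ ζ, ‖f ζ‖ₑ ^ 2 * ENNReal.ofReal (ω ‖ζ‖) ∂discArea) < ∞}

/-- `B z`, for `z` in the disc, is the reproducing kernel of `A²_ω` at `z`. -/
def IsReproducingKernel (ω : ℝ → ℝ) (B : ℂ → ℂ → ℂ) : Prop :=
  ∀ z ∈ unitDisc, B z ∈ bergmanSpace ω ∧
    ∀ f ∈ bergmanSpace ω, f z = ∫ ζ, f ζ * conj (B z ζ) * (ω ‖ζ‖ : ℂ) ∂discArea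

/-- The reproducing kernel `B^ω_z(ζ)` of `A²_ω` (written `bergmanKernel ω z ζ`). The reproducing
property determines it for all `z` and `ζ` in the disc; its other values are never used. -/
def bergmanKernel (ω : ℝ → ℝ) : ℂ → ℂ → ℂ :=
  Classical.epsilon (IsReproducingKernel ω)

/-- The Bergman projection `P_ω f(z) = ∫ f(ζ) conj(B^ω_z(ζ)) ω(ζ) dA(ζ)`. -/
def bergmanProjection (ω : ℝ → ℝ) (f : ℂ → ℂ) (z : ℂ) : ℂ :=
  ∫ ζ, f ζ * conj (bergmanKernel ω z ζ) * (ω ‖ζ‖ : ℂ) ∂discArea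

/-- The integral that defines `P_ω f` converges absolutely at every point of the disc. -/
def ProjectionDefined (ω : ℝ → ℝ) (f : ℂ → ℂ) : Prop :=
  ∀ z ∈ unitDisc,
    Integrable (fun ζ : ℂ => f ζ * conj (bergmanKernel ω z ζ) * (ω ‖ζ‖ : ℂ)) discArea

/-- `‖f‖_{∞,v} = ess sup |f(z)| v(|z|)` over the disc. -/
def growthNorm (v : ℝ → ℝ) (f : ℂ → ℂ) : ℝ≥0∞ :=
  essSup (fun z : ℂ => ‖f z‖ₑ * ENNReal.ofReal (v ‖z‖)) discArea

/-- The growth space `L^∞_v`. -/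
def growthSpace (v : ℝ → ℝ) : Set (ℂ → ℂ) :=
  {f | AEStronglyMeasurable f discArea ∧ growthNorm v f < ∞}

/-- `‖f‖_{B^∞_v} = sup (1 - |z|) v(|z|) |f'(z)|` over the disc. -/
def blochNorm (v : ℝ → ℝ) (f : ℂ → ℂ) : ℝ≥0∞ :=
  ⨆ z ∈ unitDisc, ENNReal.ofReal ((1 - ‖z‖) * v ‖z‖) * ‖deriv f z‖ₑ

/-- The Bloch type space `B^∞_v`. -/
def blochSpace (v : ℝ → ℝ) : Set (ℂ → ℂ) :=
  {f | AnalyticOnNhd ℂ f unitDisc ∧ blochNorm v f < ∞}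

/-- `P_ω : L^∞_v → B^∞_v` is (well defined and) bounded. -/
def ProjectionBounded (ω v : ℝ → ℝ) : Prop :=
  (∀ f ∈ growthSpace v, ProjectionDefined ω f ∧ bergmanProjection ω f ∈ blochSpace v) ∧
    ∃ C : ℝ≥0, ∀ f ∈ growthSpace v,
      blochNorm v (bergmanProjection ω f) ≤ C * growthNorm v f

/-- `sup_{x ≥ 0} (ν_x / ω_{2x}) (ω/ν̂)_x < ∞`. -/
def MomentCondition (ω ν : ℝ → ℝ) : Prop :=
  (⨆ x ∈ Set.Ici (0 : ℝ),
    moment ν x / moment ω (2 * x) * moment (fun s => ω s / tail ν s) x) < ∞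

/-- `sup_{0 ≤ r < 1} (ν̂(r) / ω̂(r)) ∫_r^1 ω(s)/ν̂(s) ds < ∞`. -/
def TailCondition (ω ν : ℝ → ℝ) : Prop :=
  (⨆ r ∈ Set.Ico (0 : ℝ) 1,
    ENNReal.ofReal (tail ν r / tail ω r) *
      (∫⁻ s in Set.Ico r 1, ENNReal.ofReal (ω s / tail ν s))) < ∞

end BergmanGrowth

end

namespace BergmanGrowth

open Set

/-! Write g = ω/ν̂, and compare the three measures ν ds, ω ds and g ds on [0,1) through their tails
and their moments. The implications run (i) → (iii) → (ii) → (i).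

The bridge between tails and moments is that a measure with doubling tails has x-th moment at most a
constant times its tail at 1 - 1/(x+2) (`exists_lintegral_rpow_le`), while any measure satisfies the
reverse bound with the moment of order 2x (`tailMass_le_lintegral_rpow`).

(iii) → (ii). As ν̂ decreases, ω̂(r) ≤ ν̂(r) ∫_r^1 g always holds; (iii) is the converse up to a
constant. So the product of the tails of ν and g is comparable to the doubling function ω̂. Both
factors are monotone, hence each of them is doubling, although nothing was assumed of ν. The bridge
then turns the tail inequality into the moment inequality.

(ii) → (i). The kernel is K(z ζ̄) with K(w) = ∑ w^n / (2 ω_{2n+1}), and |fω| ≤ ‖f‖ g almost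
everywhere, so it is enough to bound (1-|z|) ν̂(z) ∫ |K'(z ζ̄)| g dA uniformly in z
(`exists_kerDeriv_mean_le`). Cut K' into smooth dyadic blocks of frequencies n ~ M = 2^j. Doubling
of ω makes the coefficients of a block slowly varying, and a Carlson type inequality
(`integral_norm_trigPoly_le`) bounds its L¹ mean on the circle of radius ρ by a constant times M
ρ^{2m} / ω̂(1-1/M), where m = ⌊M/8⌋. Integration in the radius produces the moment g_{2m} ≤ g_m. Of
the factor |z|^{2m}, one half is paired with ν̂(z), as |z|^m ν̂(z) ≤ ν_m, and (ii) at x = m cancels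
ω̂(1-1/M). The other half makes ∑ 2^j |z|^m ≤ 31/(1-|z|) converge, which cancels 1-|z|.

(i) → (iii). The test functions (ζ/|ζ|)^n / ν̂(ζ) have norm at most 1, and their projections are the
monomials (g_{n+1}/ω_{2n+1}) z^n. Evaluating the derivative at r with n ≈ 1/(1-r) gives ν̂(r)
g_{n+1} ≲ ω_{2n+1} ≲ ω̂(r), and g_{n+1} dominates ∫_r^1 g. -/

/-! ### Doubling measures on `[0,1)` and their moments -/

/-- The tail mass `m([1 - u, ∞))`. -/
noncomputable def tailMass (m : Measure ℝ) (u : ℝ) : ℝ≥0∞ := m (Ici (1 - u))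

/-- The tail masses of `m` satisfy the doubling condition with constant `D`. -/
def TailDoubling (m : Measure ℝ) (D : ℝ≥0) : Prop :=
  ∀ u : ℝ, 0 < u → tailMass m (2 * u) ≤ D * tailMass m u

lemma tailMass_mono (m : Measure ℝ) : Monotone (tailMass m) := fun _ _ h =>
  measure_mono (Ici_subset_Ici.2 (by linarith))

lemma TailDoubling.pow {m : Measure ℝ} {D : ℝ≥0} (h : TailDoubling m D) (k : ℕ) {u : ℝ}
    (hu : 0 < u) : tailMass m (2 ^ k * u) ≤ (D : ℝ≥0∞) ^ k * tailMass m u := by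
  induction k with
  | zero => simp
  | succ k ih =>
    calc tailMass m (2 ^ (k + 1) * u) = tailMass m (2 * (2 ^ k * u)) := by ring_nf
      _ ≤ D * tailMass m (2 ^ k * u) := h _ (by positivity)
      _ ≤ D * ((D : ℝ≥0∞) ^ k * tailMass m u) := by gcongr
      _ = (D : ℝ≥0∞) ^ (k + 1) * tailMass m u := by ring

lemma summable_exp_neg_two_pow_mul_pow (d : ℝ) (hd : 0 < d) :
    Summable fun k : ℕ => Real.exp (2 - 2 ^ k / 2) * d ^ k := by
  refine summable_of_ratio_test_tendsto_lt_one (l := 0) one_pos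
    (Eventually.of_forall fun k => by positivity) ?_
  have : ∀ k : ℕ, ‖Real.exp (2 - 2 ^ (k + 1) / 2) * d ^ (k + 1)‖ /
      ‖Real.exp (2 - 2 ^ k / 2) * d ^ k‖ = Real.exp (-(2 ^ k / 2)) * d := by
    intro k
    rw [Real.norm_of_nonneg (by positivity), Real.norm_of_nonneg (by positivity),
      div_eq_iff (by positivity)]
    have : Real.exp (2 - 2 ^ (k + 1) / 2) =
        Real.exp (-(2 ^ k / 2)) * Real.exp (2 - 2 ^ k / 2) := by
      rw [← Real.exp_add]; ring_nf
    rw [this]; ring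
  simp_rw [this]
  rw [← zero_mul d]
  refine Tendsto.mul_const _ (Real.tendsto_exp_neg_atTop_nhds_zero.comp ?_)
  exact (tendsto_pow_atTop_atTop_of_one_lt one_lt_two).atTop_div_const two_pos

/-- This is s ≤ e^{s-1}. Replacing x by x + 2 costs at most e², and keeps the scale 1/(x+2) at most
1/2 even for x = 0. -/
lemma rpow_le_exp_of_mem {s x : ℝ} (hs : s ∈ Ico (0 : ℝ) 1) (hx : 0 ≤ x) :
    s ^ x ≤ Real.exp (2 - (x + 2) * (1 - s)) := by
  calc s ^ x ≤ (Real.exp (s - 1)) ^ x :=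
        Real.rpow_le_rpow hs.1 (by linarith [Real.add_one_le_exp (s - 1)]) hx
    _ = Real.exp ((s - 1) * x) := by rw [← Real.exp_mul]
    _ ≤ _ := by
        apply Real.exp_le_exp.2
        nlinarith [hs.1, hs.2]

/-- Dyadic layers of the distance to 1, in units of 1/(x+2): a point with (x+2)(1-s) between 2^k and
2^(k+1) is charged to the term k + 1. -/
lemma ofReal_rpow_le_tsum {s x : ℝ} (hs : s ∈ Ico (0 : ℝ) 1) (hx : 0 ≤ x) :
    ENNReal.ofReal (s ^ x) ≤ ∑' k : ℕ, ENNReal.ofReal (Real.exp (2 - 2 ^ k / 2)) *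
      (Ici (1 - 2 ^ k * (1 / (x + 2)))).indicator 1 s := by
  have hy : 0 < x + 2 := by linarith
  suffices h : ∃ k : ℕ, s ^ x ≤ Real.exp (2 - 2 ^ k / 2) ∧ (x + 2) * (1 - s) ≤ 2 ^ k by
    obtain ⟨k, h1, h2⟩ := h
    have hmem : s ∈ Ici (1 - 2 ^ k * (1 / (x + 2))) := by
      rw [mem_Ici, mul_one_div, sub_le_comm, le_div_iff₀ hy]
      linarith
    refine le_trans ?_ (ENNReal.le_tsum k)
    rw [indicator_of_mem hmem, Pi.one_apply, mul_one]
    exact ENNReal.ofReal_le_ofReal h1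
  rcases le_total ((x + 2) * (1 - s)) 1 with h | h
  · refine ⟨0, ?_, by simpa using h⟩
    exact (Real.rpow_le_one hs.1 hs.2.le hx).trans (Real.one_le_exp (by norm_num))
  · obtain ⟨k, hk1, hk2⟩ := exists_nat_pow_near h (one_lt_two (α := ℝ))
    refine ⟨k + 1, (rpow_le_exp_of_mem hs hx).trans (Real.exp_le_exp.2 ?_), hk2.le⟩
    rw [pow_succ]; linarith

/-- Doubling lets the k-th layer be at most D^k times the tail at scale 1/(x+2), and the doubly
exponential weights beat D^k. -/
lemma exists_lintegral_rpow_le {m : Measure ℝ} {D : ℝ≥0} (hm : ∀ᵐ s ∂m, s ∈ Ico (0 : ℝ) 1)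
    (h : TailDoubling m D) :
    ∃ C : ℝ≥0, ∀ x : ℝ, 0 ≤ x →
      ∫⁻ s, ENNReal.ofReal (s ^ x) ∂m ≤ C * tailMass m (1 / (x + 2)) := by
  set S : ℝ≥0∞ := ∑' k : ℕ, ENNReal.ofReal (Real.exp (2 - 2 ^ k / 2)) * (D : ℝ≥0∞) ^ k
  have hS : S ≠ ∞ := by
    have hle : S ≤ ∑' k : ℕ, ENNReal.ofReal (Real.exp (2 - 2 ^ k / 2) * ((D : ℝ) + 1) ^ k) := by
      refine ENNReal.tsum_le_tsum fun k => ?_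
      rw [ENNReal.ofReal_mul (by positivity)]
      gcongr
      rw [ENNReal.ofReal_pow (by positivity)]
      gcongr
      rw [← ENNReal.ofReal_coe_nnreal]
      exact ENNReal.ofReal_le_ofReal (by linarith)
    refine ne_top_of_le_ne_top ?_ hle
    exact (summable_exp_neg_two_pow_mul_pow _ (by positivity)).tsum_ofReal_ne_top
  refine ⟨S.toNNReal, fun x hx => ?_⟩
  rw [ENNReal.coe_toNNReal hS, ← ENNReal.tsum_mul_right]
  calc ∫⁻ s, ENNReal.ofReal (s ^ x) ∂m
      ≤ ∫⁻ s, ∑' k : ℕ, ENNReal.ofReal (Real.exp (2 - 2 ^ k / 2)) *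
          (Ici (1 - 2 ^ k * (1 / (x + 2)))).indicator 1 s ∂m :=
        lintegral_mono_ae (hm.mono fun s hs => ofReal_rpow_le_tsum hs hx)
    _ = ∑' k : ℕ, ENNReal.ofReal (Real.exp (2 - 2 ^ k / 2)) *
          tailMass m (2 ^ k * (1 / (x + 2))) := by
        rw [lintegral_tsum fun k => ((measurable_one.indicator measurableSet_Ici).const_mul
          _).aemeasurable]
        congr 1 with k
        rw [lintegral_const_mul _ (measurable_one.indicator measurableSet_Ici),
          lintegral_indicator_one measurableSet_Ici, tailMass]
    _ ≤ _ := by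
        refine ENNReal.tsum_le_tsum fun k => ?_
        rw [mul_assoc]
        gcongr
        exact h.pow k (by positivity)

lemma tailMass_le_lintegral_rpow {m : Measure ℝ} (hm : ∀ᵐ s ∂m, s ∈ Ico (0 : ℝ) 1) {x : ℝ}
    (hx : 0 ≤ x) :
    tailMass m (1 / (x + 2)) ≤ 16 * ∫⁻ s, ENNReal.ofReal (s ^ (2 * x)) ∂m := by
  have hmeas : Measurable fun s : ℝ => ENNReal.ofReal (s ^ (2 * x)) := by fun_prop
  rw [tailMass, ← lintegral_indicator_one measurableSet_Ici, ← lintegral_const_mul _ hmeas]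
  refine lintegral_mono_ae (hm.mono fun s hs => ?_)
  by_cases hmem : s ∈ Ici (1 - 1 / (x + 2))
  · rw [indicator_of_mem hmem, Pi.one_apply]
    have hy : 0 < x + 2 := by linarith
    have hu : 1 / (x + 2) ≤ 1 / 2 := one_div_le_one_div_of_le two_pos (by linarith)
    have h0 : 0 ≤ 1 - 1 / (x + 2) := by linarith
    have hs0 : 0 < s := lt_of_lt_of_le (by linarith) (mem_Ici.1 hmem)
    -- Bernoulli's inequality with the full exponent x + 2 would only give 0; half of it, still at
    -- least 1, gives 1/2, and the fourth power gives 1/16.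
    have h1 : (1 / 2 : ℝ) ≤ s ^ ((x + 2) / 2) := by
      calc (1 / 2 : ℝ) = 1 + (x + 2) / 2 * (-(1 / (x + 2))) := by field_simp; norm_num
        _ ≤ (1 + -(1 / (x + 2))) ^ ((x + 2) / 2) :=
            one_add_mul_self_le_rpow_one_add (by linarith) (by linarith)
        _ ≤ s ^ ((x + 2) / 2) :=
            Real.rpow_le_rpow (by linarith) (by linarith [mem_Ici.1 hmem]) (by linarith)
    have h2 : (1 / 16 : ℝ) ≤ s ^ (2 * x) := by
      calc (1 / 16 : ℝ) = (1 / 2) ^ 4 := by norm_num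
        _ ≤ (s ^ ((x + 2) / 2)) ^ 4 := by gcongr
        _ = s ^ (2 * (x + 2)) := by
            rw [← Real.rpow_natCast, ← Real.rpow_mul hs.1]; push_cast; ring_nf
        _ ≤ s ^ (2 * x) := Real.rpow_le_rpow_of_exponent_ge hs0 hs.2.le (by linarith)
    calc (1 : ℝ≥0∞) = 16 * ENNReal.ofReal (1 / 16) := by
          rw [← ENNReal.ofReal_ofNat, ← ENNReal.ofReal_mul (by norm_num)]; norm_num
      _ ≤ _ := by gcongr
  · rw [indicator_of_notMem hmem]; exact zero_le

/-- Doubling near the endpoint gives doubling at all scales: at a coarse scale the smaller tail is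
at least `m (Ici ((1 + r₀) / 2)) > 0`, while the larger one is at most the finite total mass. -/
lemma exists_tailDoubling {m : Measure ℝ} [IsFiniteMeasure m] {C : ℝ≥0} {r₀ : ℝ}
    (hpos : m (Ici ((1 + r₀) / 2)) ≠ 0)
    (h : ∀ r, r₀ ≤ r → r < 1 → m (Ici r) ≤ C * m (Ici ((1 + r) / 2))) :
    ∃ D : ℝ≥0, TailDoubling m D := by
  set E : ℝ≥0∞ := m univ / m (Ici ((1 + r₀) / 2))
  have hE : E ≠ ∞ := ENNReal.div_ne_top (measure_ne_top _ _) hpos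
  refine ⟨C + E.toNNReal, fun u hu => ?_⟩
  rw [ENNReal.coe_add, ENNReal.coe_toNNReal hE, add_mul]
  rcases le_total r₀ (1 - 2 * u) with hr | hr
  · refine le_trans ?_ le_self_add
    have h1 := h _ hr (by linarith)
    rwa [show (1 + (1 - 2 * u)) / 2 = 1 - u by ring] at h1
  · refine le_trans ?_ le_add_self
    calc tailMass m (2 * u) ≤ m univ := measure_mono (subset_univ _)
      _ = E * m (Ici ((1 + r₀) / 2)) :=
          (ENNReal.div_mul_cancel hpos (measure_ne_top _ _)).symm
      _ ≤ E * tailMass m u := by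
          gcongr
          exact measure_mono (Ici_subset_Ici.2 (by linarith))

/-! ### Radial weights as measures -/

/-- The measure `g(s) ds` on `[0,1)`. -/
noncomputable def radialMeasure (g : ℝ → ℝ) : Measure ℝ :=
  (volume.restrict (Ico (0 : ℝ) 1)).withDensity fun s => ENNReal.ofReal (g s)

lemma ae_mem_radialMeasure (g : ℝ → ℝ) : ∀ᵐ s ∂radialMeasure g, s ∈ Ico (0 : ℝ) 1 :=
  (withDensity_absolutelyContinuous _ _).ae_le (ae_restrict_mem measurableSet_Ico)

lemma lintegral_radialMeasure {g : ℝ → ℝ} (hg : AEMeasurable g (volume.restrict (Ico (0 : ℝ) 1)))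
    {x : ℝ} : ∫⁻ s, ENNReal.ofReal (s ^ x) ∂radialMeasure g = moment g x := by
  rw [radialMeasure, lintegral_withDensity_eq_lintegral_mul₀ hg.ennreal_ofReal (by fun_prop),
    moment]
  refine setLIntegral_congr_fun measurableSet_Ico fun s hs => ?_
  rw [Pi.mul_apply, mul_comm, ENNReal.ofReal_mul (Real.rpow_nonneg hs.1 _)]

lemma radialMeasure_Ici (g : ℝ → ℝ) {r : ℝ} (hr : 0 ≤ r) :
    radialMeasure g (Ici r) = ∫⁻ s in Ico r 1, ENNReal.ofReal (g s) := by
  rw [radialMeasure, withDensity_apply _ measurableSet_Ici, Measure.restrict_restrict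
    measurableSet_Ici]
  congr 2
  ext s
  simp only [mem_inter_iff, mem_Ici, mem_Ico]
  constructor
  · rintro ⟨h1, -, h2⟩; exact ⟨h1, h2⟩
  · rintro ⟨h1, h2⟩; exact ⟨h1, hr.trans h1, h2⟩

lemma tailMass_radialMeasure_of_one_le (g : ℝ → ℝ) {u : ℝ} (hu : 1 ≤ u) :
    tailMass (radialMeasure g) u = tailMass (radialMeasure g) 1 := by
  refine measure_congr ?_
  filter_upwards [ae_mem_radialMeasure g] with s hs
  refine propext ⟨fun _ => ?_, fun _ => ?_⟩
  · show 1 - 1 ≤ s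
    linarith [hs.1]
  · show 1 - u ≤ s
    linarith [hs.1]

namespace IsRadialWeight

variable {ω : ℝ → ℝ}

lemma integrableOn_subset (h : IsRadialWeight ω) {r : ℝ} (hr : 0 ≤ r) :
    IntegrableOn ω (Ico r 1) := h.integrableOn.mono_set (Ico_subset_Ico_left hr)

lemma aemeasurable (h : IsRadialWeight ω) : AEMeasurable ω (volume.restrict (Ico (0 : ℝ) 1)) :=
  h.integrableOn.aestronglyMeasurable.aemeasurable

lemma tail_eq_setIntegral (ω : ℝ → ℝ) {r : ℝ} (hr : r ∈ Ico (0 : ℝ) 1) :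
    tail ω r = ∫ s in Ico r 1, ω s := by
  rw [tail, intervalIntegral.integral_of_le hr.2.le, integral_Ioc_eq_integral_Ioo,
    integral_Ico_eq_integral_Ioo]

lemma ofReal_tail (h : IsRadialWeight ω) {r : ℝ} (hr : r ∈ Ico (0 : ℝ) 1) :
    ENNReal.ofReal (tail ω r) = radialMeasure ω (Ici r) := by
  rw [tail_eq_setIntegral ω hr, radialMeasure_Ici ω hr.1,
    ofReal_integral_eq_lintegral_ofReal (h.integrableOn_subset hr.1)]
  filter_upwards [ae_restrict_mem measurableSet_Ico] with s hs
  exact h.nonneg s ⟨hr.1.trans hs.1, hs.2⟩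

lemma tailMass_eq (h : IsRadialWeight ω) {u : ℝ} (hu : 0 < u) (hu1 : u ≤ 1) :
    tailMass (radialMeasure ω) u = ENNReal.ofReal (tail ω (1 - u)) :=
  (h.ofReal_tail ⟨by linarith, by linarith⟩).symm

lemma isFiniteMeasure (h : IsRadialWeight ω) : IsFiniteMeasure (radialMeasure ω) := by
  refine ⟨?_⟩
  rw [radialMeasure, withDensity_apply _ MeasurableSet.univ, Measure.restrict_univ]
  exact h.integrableOn.lintegral_lt_top

lemma tail_anti (h : IsRadialWeight ω) : AntitoneOn (tail ω) (Ico 0 1) := by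
  intro r hr s hs hrs
  have := h.isFiniteMeasure
  rw [← ENNReal.ofReal_le_ofReal_iff (h.tail_pos r hr).le, h.ofReal_tail hr, h.ofReal_tail hs]
  exact measure_mono (Ici_subset_Ici.2 hrs)

lemma aemeasurable_tail (h : IsRadialWeight ω) :
    AEMeasurable (tail ω) (volume.restrict (Ico (0 : ℝ) 1)) :=
  aemeasurable_restrict_of_antitoneOn measurableSet_Ico h.tail_anti

lemma tailMass_pos (h : IsRadialWeight ω) {u : ℝ} (hu : 0 < u) :
    tailMass (radialMeasure ω) u ≠ 0 := by
  rcases le_total u 1 with h1 | h1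
  · rw [h.tailMass_eq hu h1]
    exact (ENNReal.ofReal_pos.2 (h.tail_pos _ ⟨by linarith, by linarith⟩)).ne'
  · rw [tailMass_radialMeasure_of_one_le ω h1, h.tailMass_eq one_pos le_rfl]
    exact (ENNReal.ofReal_pos.2 (h.tail_pos _ ⟨by norm_num, by norm_num⟩)).ne'

lemma tailMass_ne_top (h : IsRadialWeight ω) (u : ℝ) : tailMass (radialMeasure ω) u ≠ ∞ := by
  have := h.isFiniteMeasure
  exact measure_ne_top _ _

lemma exists_tailDoubling (h : IsRadialWeight ω) (hD : UpperDoubling ω) :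
    ∃ D : ℝ≥0, TailDoubling (radialMeasure ω) D := by
  have := h.isFiniteMeasure
  obtain ⟨C, hC, hev⟩ := hD
  obtain ⟨l, hl, hI⟩ := (mem_nhdsLT_iff_exists_Ioo_subset' (show (0 : ℝ) < 1 by norm_num)).1 hev
  -- A point strictly above `l`, so that the doubling holds from `r₀` on, and nonnegative, so that
  -- the tails there are those of the weight.
  set r₀ : ℝ := (1 + max l 0) / 2
  have hl1 : max l 0 < 1 := max_lt hl one_pos
  have hr₀ : max l 0 < r₀ := by simp only [r₀]; linarith
  have hr₀1 : r₀ < 1 := by simp only [r₀]; linarith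
  have hmem : ∀ r, r₀ ≤ r → r < 1 → r ∈ Ico (0 : ℝ) 1 := fun r h1 h2 =>
    ⟨(le_max_right l 0).trans (hr₀.le.trans h1), h2⟩
  refine BergmanGrowth.exists_tailDoubling (C := C.toNNReal) (r₀ := r₀) ?_ fun r hr hr1 => ?_
  · rw [← h.ofReal_tail (hmem _ (by linarith) (by linarith))]
    exact (ENNReal.ofReal_pos.2 (h.tail_pos _ (hmem _ (by linarith) (by linarith)))).ne'
  · rw [← h.ofReal_tail (hmem _ hr hr1), ← h.ofReal_tail (hmem _ (by linarith) (by linarith))]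
    show _ ≤ ENNReal.ofReal C * _
    rw [← ENNReal.ofReal_mul hC.le]
    exact ENNReal.ofReal_le_ofReal (hI ⟨(le_max_left l 0).trans_lt (hr₀.trans_le hr), hr1⟩)

lemma moment_ne_top (h : IsRadialWeight ω) {x : ℝ} (hx : 0 ≤ x) : moment ω x ≠ ∞ := by
  have := h.isFiniteMeasure
  rw [← lintegral_radialMeasure h.aemeasurable]
  refine ne_top_of_le_ne_top (measure_ne_top (radialMeasure ω) univ) ?_
  rw [← lintegral_one]
  refine lintegral_mono_ae ((ae_mem_radialMeasure ω).mono fun s hs => ?_)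
  simpa using Real.rpow_le_one hs.1 hs.2.le hx

lemma moment_ne_zero (h : IsRadialWeight ω) {x : ℝ} (hx : 0 ≤ x) : moment ω x ≠ 0 := by
  intro h0
  have h1 := tailMass_le_lintegral_rpow (ae_mem_radialMeasure ω) (x := x / 2) (by positivity)
  rw [lintegral_radialMeasure h.aemeasurable, mul_div_cancel₀ _ two_ne_zero, h0, mul_zero,
    nonpos_iff_eq_zero] at h1
  exact h.tailMass_pos (by positivity) h1

end IsRadialWeight

lemma moment_anti (g : ℝ → ℝ) (hg : ∀ r ∈ Ico (0 : ℝ) 1, 0 ≤ g r) {x y : ℝ} (hx : 0 ≤ x)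
    (hxy : x ≤ y) : moment g y ≤ moment g x := by
  refine setLIntegral_mono_ae' measurableSet_Ico (ae_of_all _ fun s hs => ?_)
  refine ENNReal.ofReal_le_ofReal (mul_le_mul_of_nonneg_right ?_ (hg s hs))
  rcases hs.1.eq_or_lt with h0 | h0
  · rw [← h0]
    rcases hx.eq_or_lt with h | h
    · rw [← h, Real.rpow_zero]; exact Real.zero_rpow_le_one _
    · rw [Real.zero_rpow h.ne', Real.zero_rpow (h.trans_le hxy).ne']
  · exact Real.rpow_le_rpow_of_exponent_ge h0 hs.2.le hxy

/-! ### The tail condition implies the moment condition -/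

section Quotient

variable {ν ω : ℝ → ℝ}

lemma aemeasurable_quotient (hν : IsRadialWeight ν) (hω : IsRadialWeight ω) :
    AEMeasurable (fun s => ω s / tail ν s) (volume.restrict (Ico (0 : ℝ) 1)) :=
  hω.aemeasurable.div hν.aemeasurable_tail

lemma quotient_nonneg (hν : IsRadialWeight ν) (hω : IsRadialWeight ω) :
    ∀ r ∈ Ico (0 : ℝ) 1, 0 ≤ ω r / tail ν r := fun r hr =>
  div_nonneg (hω.nonneg r hr) (hν.tail_pos r hr).le

/-- The half of the comparison that needs no hypothesis on the pair: ν̂(r)/ν̂(s) ≥ 1 for s ≥ r. -/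
lemma tailMass_le_mul_quotient (hν : IsRadialWeight ν) (hω : IsRadialWeight ω) {u : ℝ}
    (hu : 0 < u) (hu1 : u ≤ 1) :
    tailMass (radialMeasure ω) u ≤ tailMass (radialMeasure ν) u *
      tailMass (radialMeasure fun s => ω s / tail ν s) u := by
  have hr : 1 - u ∈ Ico (0 : ℝ) 1 := ⟨by linarith, by linarith⟩
  rw [hν.tailMass_eq hu hu1, tailMass, tailMass, radialMeasure_Ici _ hr.1,
    radialMeasure_Ici _ hr.1, ← lintegral_const_mul' _ _ ENNReal.ofReal_ne_top]
  refine setLIntegral_mono_ae' measurableSet_Ico (ae_of_all _ fun s hs => ?_)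
  have hs' : s ∈ Ico (0 : ℝ) 1 := ⟨hr.1.trans hs.1, hs.2⟩
  rw [← ENNReal.ofReal_mul (hν.tail_pos _ hr).le]
  refine ENNReal.ofReal_le_ofReal ?_
  rw [← mul_div_assoc, le_div_iff₀ (hν.tail_pos s hs'), mul_comm]
  exact mul_le_mul_of_nonneg_right (hν.tail_anti hr hs' hs.1) (hω.nonneg s hs')

lemma TailCondition.exists_tailMass_mul_le (hν : IsRadialWeight ν) (hω : IsRadialWeight ω)
    (h : TailCondition ω ν) :
    ∃ S : ℝ≥0, ∀ u : ℝ, 0 < u → u ≤ 1 → tailMass (radialMeasure ν) u *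
      tailMass (radialMeasure fun s => ω s / tail ν s) u ≤ S * tailMass (radialMeasure ω) u := by
  lift (⨆ r ∈ Ico (0 : ℝ) 1, ENNReal.ofReal (tail ν r / tail ω r) *
    (∫⁻ s in Set.Ico r 1, ENNReal.ofReal (ω s / tail ν s))) to ℝ≥0 using LT.lt.ne h with S hS
  refine ⟨S, fun u hu hu1 => ?_⟩
  rw [hS]
  have hr : 1 - u ∈ Ico (0 : ℝ) 1 := ⟨by linarith, by linarith⟩
  have h1 := le_iSup₂ (f := fun (r : ℝ) (_ : r ∈ Ico (0 : ℝ) 1) =>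
    ENNReal.ofReal (tail ν r / tail ω r) *
    (∫⁻ s in Set.Ico r 1, ENNReal.ofReal (ω s / tail ν s))) (1 - u) hr
  refine le_trans (le_of_eq ?_) (mul_le_mul_left h1 (tailMass (radialMeasure ω) u))
  rw [hν.tailMass_eq hu hu1, hω.tailMass_eq hu hu1, tailMass, radialMeasure_Ici _ hr.1,
    mul_right_comm, ← ENNReal.ofReal_mul (div_nonneg (hν.tail_pos _ hr).le
      (hω.tail_pos _ hr).le), div_mul_cancel₀ _ (hω.tail_pos _ hr).ne']

lemma TailCondition.momentCondition (hν : IsRadialWeight ν) (hω : IsRadialWeight ω)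
    (hD : UpperDoubling ω) (h : TailCondition ω ν) : MomentCondition ω ν := by
  set g : ℝ → ℝ := fun s => ω s / tail ν s with hg
  obtain ⟨D, hD⟩ := hω.exists_tailDoubling hD
  obtain ⟨S, hS⟩ := h.exists_tailMass_mul_le hν hω
  set Tn := tailMass (radialMeasure ν) with hTn
  set Tw := tailMass (radialMeasure ω) with hTw
  set Tg := tailMass (radialMeasure g) with hTg
  -- The product of the tails of ν and ω/ν̂ lies between ω̂ and S ω̂, so it inherits the doubling of
  -- ω.
  have key : ∀ u, 0 < u → Tn (2 * u) * Tg (2 * u) ≤ (S * (D : ℝ≥0∞)) * (Tn u * Tg u) ∧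
      Tg u ≠ 0 ∧ Tg u ≠ ∞ ∧ Tn u * Tg u ≤ S * Tw u := by
    intro u hu
    have hlow : ∀ v, 0 < v → Tw v ≤ Tn v * Tg v ∧ Tn v * Tg v ≤ S * Tw v := by
      intro v hv
      rcases le_total v 1 with h1 | h1
      · exact ⟨tailMass_le_mul_quotient hν hω hv h1, hS v hv h1⟩
      · simp only [hTn, hTw, hTg, tailMass_radialMeasure_of_one_le _ h1]
        exact ⟨tailMass_le_mul_quotient hν hω one_pos le_rfl, hS 1 one_pos le_rfl⟩
    refine ⟨?_, fun h0 => ?_, fun h0 => ?_, (hlow u hu).2⟩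
    · calc Tn (2 * u) * Tg (2 * u) ≤ S * Tw (2 * u) := (hlow _ (by positivity)).2
        _ ≤ S * (D * Tw u) := by gcongr; exact hD u hu
        _ ≤ S * (D * (Tn u * Tg u)) := by gcongr; exact (hlow u hu).1
        _ = _ := by ring
    · have := (hlow u hu).1
      rw [h0, mul_zero, nonpos_iff_eq_zero] at this
      exact hω.tailMass_pos hu this
    · have := (hlow u hu).2
      rw [h0, ENNReal.mul_top (hν.tailMass_pos hu), top_le_iff] at this
      exact ENNReal.mul_ne_top ENNReal.coe_ne_top (hω.tailMass_ne_top u) this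
  have hmono : ∀ (m : Measure ℝ) u, 0 < u → tailMass m u ≤ tailMass m (2 * u) := fun m u hu =>
    tailMass_mono m (by linarith)
  -- A doubling product of monotone factors has doubling factors: replace `Tg (2 * u)` by the
  -- smaller `Tg u` on the left and cancel it, which is legitimate because it is neither 0 nor ∞.
  have hDn : TailDoubling (radialMeasure ν) (S * D) := fun u hu => by
    obtain ⟨h1, h2, h3, -⟩ := key u hu
    rw [← ENNReal.mul_le_mul_iff_left h2 h3, mul_assoc, ENNReal.coe_mul]
    exact le_trans (mul_le_mul_right (hmono _ u hu) _) h1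
  have hDg : TailDoubling (radialMeasure g) (S * D) := fun u hu => by
    obtain ⟨h1, -, -, -⟩ := key u hu
    rw [← ENNReal.mul_le_mul_iff_right (hν.tailMass_pos hu) (hν.tailMass_ne_top u),
      mul_left_comm, ENNReal.coe_mul]
    exact le_trans (mul_le_mul_left (hmono _ u hu) _) h1
  obtain ⟨C₁, hC₁⟩ := exists_lintegral_rpow_le (ae_mem_radialMeasure ν) hDn
  obtain ⟨C₂, hC₂⟩ := exists_lintegral_rpow_le (ae_mem_radialMeasure g) hDg
  refine lt_of_le_of_lt (b := ((C₁ * C₂ * S * 16 : ℝ≥0) : ℝ≥0∞)) ?_ ENNReal.coe_lt_top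
  refine iSup₂_le fun x (hx : 0 ≤ x) => ?_
  have hu : 0 < 1 / (x + 2) := by positivity
  have h1 := hC₁ x hx
  have h2 := hC₂ x hx
  have h3 := tailMass_le_lintegral_rpow (ae_mem_radialMeasure ω) hx
  rw [lintegral_radialMeasure hν.aemeasurable] at h1
  rw [lintegral_radialMeasure (aemeasurable_quotient hν hω)] at h2
  rw [lintegral_radialMeasure hω.aemeasurable] at h3
  rw [mul_comm, ← mul_div_assoc]
  refine ENNReal.div_le_of_le_mul ?_
  calc moment g x * moment ν x
      ≤ (C₂ * Tg (1 / (x + 2))) * (C₁ * Tn (1 / (x + 2))) := by gcongr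
    _ = (C₁ * C₂) * (Tn (1 / (x + 2)) * Tg (1 / (x + 2))) := by ring
    _ ≤ (C₁ * C₂) * (S * (16 * moment ω (2 * x))) :=
        mul_le_mul_right (((key _ hu).2.2.2).trans (mul_le_mul_right h3 _)) _
    _ = _ := by push_cast; ring

end Quotient

/-! ### An `L¹` estimate for trigonometric polynomials -/

lemma integral_cos_int_mul (k : ℤ) (hk : k ≠ 0) :
    ∫ θ in (-Real.pi)..Real.pi, Real.cos (k * θ) = 0 := by
  have hk' : (k : ℝ) ≠ 0 := by exact_mod_cast hk
  rw [intervalIntegral.integral_comp_mul_left (fun x => Real.cos x) hk', integral_cos]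
  simp [Real.sin_int_mul_pi]

lemma integral_exp_int_mul_I (k : ℤ) :
    ∫ θ in (-Real.pi)..Real.pi, Complex.exp (k * θ * Complex.I) =
      if k = 0 then 2 * Real.pi else 0 := by
  split_ifs with h
  · simp [h]; ring
  · have hc : (k : ℂ) * Complex.I ≠ 0 := by simp [h]
    have := integral_exp_mul_complex (a := -Real.pi) (b := Real.pi) hc
    simp only [mul_right_comm _ Complex.I] at this
    rw [this, Complex.ofReal_zero, div_eq_zero_iff, sub_eq_zero]
    left
    rw [Complex.exp_eq_exp_iff_exists_int]
    exact ⟨k, by push_cast; ring⟩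

/-- The trigonometric polynomial `∑_{n < L} b_n e^{inθ}`. -/
noncomputable def trigPoly (b : ℕ → ℝ) (L : ℕ) (θ : ℝ) : ℂ :=
  ∑ n ∈ Finset.range L, (b n : ℂ) * Complex.exp (n * θ * Complex.I)

lemma continuous_trigPoly (b : ℕ → ℝ) (L : ℕ) : Continuous (trigPoly b L) := by
  unfold trigPoly; fun_prop

lemma normSq_trigPoly (b : ℕ → ℝ) (L : ℕ) (θ : ℝ) :
    ‖trigPoly b L θ‖ ^ 2 = ∑ m ∈ Finset.range L, ∑ n ∈ Finset.range L,
      b m * b n * Real.cos (((m - n : ℤ) : ℝ) * θ) := by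
  have h : ((‖trigPoly b L θ‖ ^ 2 : ℝ) : ℂ) = trigPoly b L θ * conj (trigPoly b L θ) := by
    rw [Complex.mul_conj, Complex.normSq_eq_norm_sq]
  have h2 : ‖trigPoly b L θ‖ ^ 2 = (trigPoly b L θ * conj (trigPoly b L θ)).re := by
    rw [← h, Complex.ofReal_re]
  rw [h2, trigPoly, map_sum, Finset.sum_mul_sum, Complex.re_sum]
  refine Finset.sum_congr rfl fun m _ => ?_
  rw [Complex.re_sum]
  refine Finset.sum_congr rfl fun n _ => ?_
  rw [map_mul, Complex.conj_ofReal, ← Complex.exp_conj, mul_mul_mul_comm, ← Complex.exp_add,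
    ← Complex.ofReal_mul, Complex.re_ofReal_mul]
  congr 1
  have : (m : ℂ) * θ * Complex.I + conj ((n : ℂ) * θ * Complex.I) =
      (((m - n : ℤ) : ℝ) * θ : ℝ) * Complex.I := by
    simp; ring
  rw [this, Complex.exp_ofReal_mul_I_re]

lemma integral_normSq_trigPoly (b : ℕ → ℝ) (L : ℕ) :
    ∫ θ in (-Real.pi)..Real.pi, ‖trigPoly b L θ‖ ^ 2 =
      2 * Real.pi * ∑ n ∈ Finset.range L, b n ^ 2 := by
  simp_rw [normSq_trigPoly]
  rw [intervalIntegral.integral_finsetSum fun m _ =>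
    (by fun_prop : Continuous _).intervalIntegrable _ _, Finset.mul_sum]
  refine Finset.sum_congr rfl fun m hm => ?_
  rw [intervalIntegral.integral_finsetSum fun n _ =>
    (by fun_prop : Continuous _).intervalIntegrable _ _, Finset.sum_eq_single m]
  · simp; ring
  · intro n _ hn
    rw [intervalIntegral.integral_const_mul, integral_cos_int_mul _ (by omega), mul_zero]
  · exact fun h => absurd hm h

/-- Summation by parts; the vanishing of `b 0` and `b L` removes the boundary terms. -/
lemma one_sub_exp_mul_trigPoly (b : ℕ → ℝ) (L : ℕ) (θ : ℝ) (h0 : b 0 = 0) (hL : b L = 0) :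
    (1 - Complex.exp (θ * Complex.I)) * trigPoly b L θ =
      Complex.exp (θ * Complex.I) * trigPoly (fun n => b (n + 1) - b n) L θ := by
  have hshift : Complex.exp (θ * Complex.I) * trigPoly (fun n => b (n + 1)) L θ =
      trigPoly b L θ := by
    have h1 : trigPoly b (L + 1) θ = trigPoly b L θ := by
      simp [trigPoly, Finset.sum_range_succ, hL]
    rw [← h1, trigPoly, trigPoly, Finset.sum_range_succ', h0, Finset.mul_sum]
    simp only [Complex.ofReal_zero, zero_mul, add_zero]
    refine Finset.sum_congr rfl fun n _ => ?_
    rw [mul_left_comm, ← Complex.exp_add]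
    push_cast; ring_nf
  have hsub : trigPoly (fun n => b (n + 1) - b n) L θ =
      trigPoly (fun n => b (n + 1)) L θ - trigPoly b L θ := by
    simp only [trigPoly, ← Finset.sum_sub_distrib]
    refine Finset.sum_congr rfl fun n _ => ?_
    push_cast; ring
  rw [hsub, mul_sub, hshift]; ring

lemma sq_div_four_le_normSq_one_sub_exp {θ : ℝ} (hθ : |θ| ≤ Real.pi) :
    θ ^ 2 / 4 ≤ ‖1 - Complex.exp (θ * Complex.I)‖ ^ 2 := by
  have h1 : ‖1 - Complex.exp (θ * Complex.I)‖ ^ 2 = 2 - 2 * Real.cos θ := by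
    rw [← Complex.normSq_eq_norm_sq, Complex.normSq_apply]
    simp only [Complex.sub_re, Complex.one_re, Complex.exp_ofReal_mul_I_re, Complex.sub_im,
      Complex.one_im, Complex.exp_ofReal_mul_I_im]
    nlinarith [Real.sin_sq_add_cos_sq θ]
  have h2 := Real.cos_le_one_sub_mul_cos_sq hθ
  have hpi : Real.pi ^ 2 ≤ 16 := by nlinarith [Real.pi_le_four, Real.pi_pos]
  have h3 : (1 : ℝ) / 8 ≤ 2 / Real.pi ^ 2 := by
    rw [div_le_div_iff₀ (by norm_num) (by positivity)]; linarith
  nlinarith [mul_le_mul_of_nonneg_right h3 (sq_nonneg θ)]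

lemma integral_inv_one_add_sq_le {c : ℝ} (hc : 0 < c) :
    ∫ θ in (-Real.pi)..Real.pi, (1 + (c * θ) ^ 2)⁻¹ ≤ c⁻¹ * Real.pi := by
  rw [intervalIntegral.integral_comp_mul_left (fun x => (1 + x ^ 2)⁻¹) hc.ne',
    integral_inv_one_add_sq, smul_eq_mul]
  gcongr
  linarith [Real.arctan_lt_pi_div_two (c * Real.pi), Real.neg_pi_div_two_lt_arctan (c * -Real.pi)]

/-- A Carlson type inequality: if the coefficients are bounded by `X`, their increments by
`4 X / M`, and there are at most `3 M` of them, then the `L¹` norm is at most a constant times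
`X`. -/
lemma integral_norm_trigPoly_le {b : ℕ → ℝ} {L : ℕ} {M X : ℝ} (hM : 0 < M) (hX0 : 0 ≤ X)
    (h0 : b 0 = 0) (hL : b L = 0) (hLM : (L : ℝ) ≤ 3 * M) (hb : ∀ n, |b n| ≤ X)
    (hd : ∀ n, |b (n + 1) - b n| ≤ 4 * X / M) :
    ∫ θ in (-Real.pi)..Real.pi, ‖trigPoly b L θ‖ ≤ 52 * Real.pi * X := by
  have hpi := Real.pi_pos
  rcases hX0.eq_or_lt with rfl | hX
  · have hb0 : ∀ n, b n = 0 := fun n => abs_nonpos_iff.1 (hb n)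
    simp [trigPoly, hb0]
  set Δ : ℕ → ℝ := fun n => b (n + 1) - b n with hΔ
  have hsum : ∀ (a : ℕ → ℝ) (Y : ℝ), (∀ n, |a n| ≤ Y) →
      ∑ n ∈ Finset.range L, a n ^ 2 ≤ 3 * M * Y ^ 2 := by
    intro a Y ha
    calc ∑ n ∈ Finset.range L, a n ^ 2 ≤ ∑ _n ∈ Finset.range L, Y ^ 2 :=
          Finset.sum_le_sum fun n _ => by
            rw [← sq_abs]; exact pow_le_pow_left₀ (abs_nonneg _) (ha n) 2
      _ = L * Y ^ 2 := by simp
      _ ≤ _ := by gcongr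
  -- Cauchy–Schwarz in its pointwise form, with the weight q = 1 + (Mθ/2)². Since |1 - e^{iθ}| ≥
  -- |θ|/2, the quantity q F² is controlled by F and by the polynomial of the increments, whose L²
  -- norms Parseval computes. The balance `M * X` makes every contribution a multiple of πX, namely
  -- 3 + 48 + 1 = 52.
  have hpt : ∀ θ ∈ Icc (-Real.pi) Real.pi, ‖trigPoly b L θ‖ ≤
      (1 / (2 * (M * X))) * (‖trigPoly b L θ‖ ^ 2 + M ^ 2 * ‖trigPoly Δ L θ‖ ^ 2) +
      (M * X / 2) * (1 + (M / 2 * θ) ^ 2)⁻¹ := by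
    intro θ hθ
    set F := ‖trigPoly b L θ‖ with hF
    set q := 1 + (M / 2 * θ) ^ 2 with hq
    have hq0 : 0 < q := by positivity
    have h1 : ‖trigPoly Δ L θ‖ = ‖1 - Complex.exp (θ * Complex.I)‖ * F := by
      rw [hF, ← norm_mul, one_sub_exp_mul_trigPoly b L θ h0 hL, norm_mul,
        Complex.norm_exp_ofReal_mul_I, one_mul]
    have h2 : q * F ^ 2 ≤ F ^ 2 + M ^ 2 * ‖trigPoly Δ L θ‖ ^ 2 := by
      have := sq_div_four_le_normSq_one_sub_exp (abs_le.2 hθ)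
      have h3 := mul_le_mul_of_nonneg_left this (by positivity : 0 ≤ M ^ 2 * F ^ 2)
      rw [h1, hq]; nlinarith
    have h4 : F ≤ (1 / (2 * (M * X))) * (q * F ^ 2) + (M * X / 2) * q⁻¹ := by
      have : (1 / (2 * (M * X))) * (q * F ^ 2) + (M * X / 2) * q⁻¹ - F =
          (q * F - M * X) ^ 2 / (2 * (M * X) * q) := by
        field_simp; ring
      have h5 : 0 ≤ (q * F - M * X) ^ 2 / (2 * (M * X) * q) := by positivity
      linarith
    refine h4.trans ?_
    gcongr
  have hcb := continuous_trigPoly b L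
  have hcd := continuous_trigPoly Δ L
  have hi1 : IntervalIntegrable (fun θ => ‖trigPoly b L θ‖ ^ 2) volume (-Real.pi) Real.pi :=
    (by fun_prop : Continuous _).intervalIntegrable _ _
  have hi2 : IntervalIntegrable (fun θ => M ^ 2 * ‖trigPoly Δ L θ‖ ^ 2) volume
      (-Real.pi) Real.pi := (by fun_prop : Continuous _).intervalIntegrable _ _
  have hi3 : IntervalIntegrable (fun θ : ℝ => (1 + (M / 2 * θ) ^ 2)⁻¹) volume
      (-Real.pi) Real.pi := by
    refine Continuous.intervalIntegrable (Continuous.inv₀ (by fun_prop) fun θ => ?_) _ _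
    positivity
  calc ∫ θ in (-Real.pi)..Real.pi, ‖trigPoly b L θ‖
      ≤ ∫ θ in (-Real.pi)..Real.pi, ((1 / (2 * (M * X))) *
          (‖trigPoly b L θ‖ ^ 2 + M ^ 2 * ‖trigPoly Δ L θ‖ ^ 2) +
          (M * X / 2) * (1 + (M / 2 * θ) ^ 2)⁻¹) := by
        refine intervalIntegral.integral_mono_on (by linarith)
          (hcb.norm.intervalIntegrable _ _) ?_ hpt
        exact ((hi1.add hi2).const_mul _).add (hi3.const_mul _)
    _ = (1 / (2 * (M * X))) * (2 * Real.pi * ∑ n ∈ Finset.range L, b n ^ 2 +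
          M ^ 2 * (2 * Real.pi * ∑ n ∈ Finset.range L, Δ n ^ 2)) +
          (M * X / 2) * ∫ θ in (-Real.pi)..Real.pi, (1 + (M / 2 * θ) ^ 2)⁻¹ := by
        rw [intervalIntegral.integral_add ((hi1.add hi2).const_mul _) (hi3.const_mul _),
          intervalIntegral.integral_const_mul, intervalIntegral.integral_const_mul,
          intervalIntegral.integral_add hi1 hi2, intervalIntegral.integral_const_mul,
          integral_normSq_trigPoly, integral_normSq_trigPoly]
    _ ≤ (1 / (2 * (M * X))) * (2 * Real.pi * (3 * M * X ^ 2) +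
          M ^ 2 * (2 * Real.pi * (3 * M * (4 * X / M) ^ 2))) +
          (M * X / 2) * ((M / 2)⁻¹ * Real.pi) := by
        gcongr
        · exact hsum b X hb
        · exact hsum Δ _ hd
        · exact integral_inv_one_add_sq_le (by positivity)
    _ = 52 * Real.pi * X := by field_simp; ring

/-! ### Polar coordinates for the normalized area measure -/

/-- The measure `r dr / π` on `[0,1)`. -/
noncomputable def radiusMeasure : Measure ℝ :=
  (volume.restrict (Ico (0 : ℝ) 1)).withDensity fun r => ENNReal.ofReal (r / Real.pi)

instance : SFinite radiusMeasure := by unfold radiusMeasure; infer_instance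

/-- The point `r e^{iθ}`. -/
noncomputable def polarPoint (p : ℝ × ℝ) : ℂ := p.1 * Complex.exp (p.2 * Complex.I)

lemma measurable_polarPoint : Measurable polarPoint := by unfold polarPoint; fun_prop

lemma norm_polarPoint {r : ℝ} (hr : 0 ≤ r) (θ : ℝ) : ‖polarPoint (r, θ)‖ = r := by
  simp [polarPoint, Complex.norm_exp_ofReal_mul_I, abs_of_nonneg hr]

lemma discArea_eq_map : discArea =
    (radiusMeasure.prod (volume.restrict (Ioo (-Real.pi) Real.pi))).map polarPoint := by
  classical
  ext s hs
  rw [Measure.map_apply measurable_polarPoint hs, radiusMeasure,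
    prod_withDensity_left (by fun_prop), Measure.prod_restrict,
    withDensity_apply _ (measurable_polarPoint hs), ← Measure.volume_eq_prod,
    ← lintegral_indicator (measurable_polarPoint hs),
    ← lintegral_indicator (measurableSet_Ico.prod measurableSet_Ioo), discArea,
    Measure.smul_apply, Measure.restrict_apply hs, smul_eq_mul,
    unitDisc, ← lintegral_indicator_one (hs.inter Metric.isOpen_ball.measurableSet),
    ← Complex.lintegral_comp_polarCoord_symm,
    ← lintegral_const_mul' _ _ ENNReal.ofReal_ne_top,
    ← lintegral_indicator polarCoord.open_target.measurableSet]
  refine lintegral_congr fun p => ?_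
  obtain ⟨r, θ⟩ := p
  have hpt : Complex.polarCoord.symm (r, θ) = polarPoint (r, θ) := by
    rw [Complex.polarCoord_symm_apply, polarPoint, Complex.exp_mul_I]; push_cast; rfl
  simp only [indicator_apply, polarCoord_target, mem_prod, mem_Ioi, mem_Ioo, mem_Ico, hpt,
    mem_inter_iff, mem_ball_zero_iff, mem_preimage, smul_eq_mul]
  rcases lt_trichotomy r 0 with h | h | h
  · simp [h.not_gt, h.not_ge]
  · simp [h]
  · rw [norm_polarPoint h.le]
    by_cases h1 : -Real.pi < θ ∧ θ < Real.pi <;> by_cases h2 : r < 1 <;>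
      by_cases h3 : polarPoint (r, θ) ∈ s <;> simp [h, h.le, h1, h2, h3]
    rw [← ENNReal.ofReal_mul (by positivity)]
    congr 1; ring

instance : IsFiniteMeasure discArea := by
  refine ⟨?_⟩
  rw [discArea, Measure.smul_apply, Measure.restrict_apply MeasurableSet.univ, univ_inter]
  exact ENNReal.mul_lt_top ENNReal.ofReal_lt_top measure_ball_lt_top

lemma ae_mem_unitDisc : ∀ᵐ z ∂discArea, z ∈ unitDisc :=
  Measure.ae_smul_measure (ae_restrict_mem Metric.isOpen_ball.measurableSet) _

lemma lintegral_discArea {F : ℂ → ℝ≥0∞} (hF : Measurable F) :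
    ∫⁻ z, F z ∂discArea = ∫⁻ r in Ico (0 : ℝ) 1, ENNReal.ofReal (r / Real.pi) *
      ∫⁻ θ in Ioo (-Real.pi) Real.pi, F (polarPoint (r, θ)) := by
  have hm : Measurable fun p => F (polarPoint p) := hF.comp measurable_polarPoint
  rw [discArea_eq_map, lintegral_map hF measurable_polarPoint, lintegral_prod _ hm.aemeasurable,
    radiusMeasure, lintegral_withDensity_eq_lintegral_mul _ (by fun_prop)
      hm.lintegral_prod_right']
  rfl

/-- Weights are only almost everywhere measurable on [0,1); this transfers their measurability and
their a.e. identities to z ↦ ω(|z|) on the disc. -/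
lemma quasiMeasurePreserving_norm :
    Measure.QuasiMeasurePreserving (fun z : ℂ => ‖z‖) discArea
      (volume.restrict (Ico (0 : ℝ) 1)) := by
  refine ⟨measurable_norm, Measure.AbsolutelyContinuous.mk fun s hs h0 => ?_⟩
  rw [Measure.map_apply measurable_norm hs, ← lintegral_indicator_one (measurable_norm hs),
    lintegral_discArea (measurable_one.indicator (measurable_norm hs)), lintegral_eq_zero_iff']
  · rw [Measure.restrict_apply hs] at h0
    have h1 : ∀ᵐ r ∂volume.restrict (Ico (0 : ℝ) 1), r ∉ s := by
      rw [ae_restrict_iff' measurableSet_Ico]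
      filter_upwards [measure_eq_zero_iff_ae_notMem.1 h0] with r hr h2 h3 using hr ⟨h3, h2⟩
    filter_upwards [h1, ae_restrict_mem measurableSet_Ico] with r hr hr1
    simp [norm_polarPoint hr1.1, hr]
  · have : Measurable fun p : ℝ × ℝ =>
        ((fun z : ℂ => ‖z‖) ⁻¹' s).indicator (1 : ℂ → ℝ≥0∞) (polarPoint p) :=
      (measurable_one.indicator (measurable_norm hs)).comp measurable_polarPoint
    exact ((by fun_prop : Measurable fun r : ℝ => ENNReal.ofReal (r / Real.pi)).mul
      this.lintegral_prod_right').aemeasurable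

lemma lintegral_mul_radial {F : ℂ → ℝ≥0∞} (hF : Measurable F) {g : ℝ → ℝ≥0∞}
    (hg : AEMeasurable g (volume.restrict (Ico (0 : ℝ) 1))) :
    ∫⁻ z, F z * g ‖z‖ ∂discArea = ∫⁻ r in Ico (0 : ℝ) 1, ENNReal.ofReal (r / Real.pi) *
      (∫⁻ θ in Ioo (-Real.pi) Real.pi, F (polarPoint (r, θ))) * g r := by
  have h1 : (fun z => F z * g ‖z‖) =ᵐ[discArea] fun z => F z * hg.mk g ‖z‖ := by
    filter_upwards [quasiMeasurePreserving_norm.ae_eq_comp hg.ae_eq_mk] with z hz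
    exact congrArg (F z * ·) hz
  have h2 : Measurable fun z : ℂ => F z * hg.mk g ‖z‖ :=
    hF.mul (hg.measurable_mk.comp measurable_norm)
  rw [lintegral_congr_ae h1, lintegral_discArea h2]
  refine lintegral_congr_ae ?_
  filter_upwards [hg.ae_eq_mk, ae_restrict_mem measurableSet_Ico] with r hr hr1
  have h3 : Measurable fun θ : ℝ => F (polarPoint (r, θ)) :=
    hF.comp (measurable_polarPoint.comp measurable_prodMk_left)
  simp only [norm_polarPoint hr1.1]
  rw [hr, lintegral_mul_const _ h3, mul_assoc]

lemma lintegral_radial {g : ℝ → ℝ≥0∞} (hg : AEMeasurable g (volume.restrict (Ico (0 : ℝ) 1))) :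
    ∫⁻ z, g ‖z‖ ∂discArea = ∫⁻ r in Ico (0 : ℝ) 1, ENNReal.ofReal (2 * r) * g r := by
  have := lintegral_mul_radial measurable_one hg
  simp only [Pi.one_apply, one_mul] at this
  rw [this]
  refine setLIntegral_congr_fun measurableSet_Ico fun r hr => ?_
  have : (0 : ℝ) ≤ r / Real.pi := div_nonneg hr.1 Real.pi_pos.le
  simp only [lintegral_one, Measure.restrict_apply MeasurableSet.univ, univ_inter,
    Real.volume_Ioo]
  rw [← ENNReal.ofReal_mul this]
  congr 2
  field_simp [Real.pi_pos.ne']; ring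

lemma integral_discArea {F : ℂ → ℂ} (hF : Integrable F discArea) :
    ∫ z, F z ∂discArea = ∫ r in Ico (0 : ℝ) 1, ((r / Real.pi : ℝ) : ℂ) *
      ∫ θ in (-Real.pi)..Real.pi, F (polarPoint (r, θ)) := by
  have hm : Integrable (fun p => F (polarPoint p))
      (radiusMeasure.prod (volume.restrict (Ioo (-Real.pi) Real.pi))) := by
    rw [discArea_eq_map] at hF
    exact hF.comp_measurable measurable_polarPoint
  rw [discArea_eq_map] at hF ⊢
  rw [integral_map measurable_polarPoint.aemeasurable hF.aestronglyMeasurable,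
    integral_prod _ hm, radiusMeasure,
    integral_withDensity_eq_integral_toReal_smul (by fun_prop)
      (ae_of_all _ fun _ => ENNReal.ofReal_lt_top)]
  refine setIntegral_congr_fun measurableSet_Ico fun r hr => ?_
  have : (0 : ℝ) ≤ r / Real.pi := div_nonneg hr.1 Real.pi_pos.le
  simp only [ENNReal.toReal_ofReal this, Complex.real_smul]
  rw [intervalIntegral.integral_of_le (by linarith [Real.pi_pos]), integral_Ioc_eq_integral_Ioo]

/-- An integral over the disc in terms of the circular means of the integrand. -/
lemma integral_mul_radial {F : ℂ → ℂ} {u : ℝ → ℝ}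
    (hF : Integrable (fun z => F z * (u ‖z‖ : ℂ)) discArea) {c : ℝ → ℂ}
    (hc : ∀ r ∈ Ioo (0 : ℝ) 1, ∫ θ in (-Real.pi)..Real.pi, F (polarPoint (r, θ)) =
      2 * Real.pi * c r) :
    ∫ z, F z * (u ‖z‖ : ℂ) ∂discArea = ∫ r in Ico (0 : ℝ) 1, 2 * r * c r * (u r : ℂ) := by
  rw [integral_discArea hF]
  refine setIntegral_congr_fun measurableSet_Ico fun r hr => ?_
  -- At r = 0 the Jacobian vanishes, so the circular mean is not needed there.
  rcases hr.1.eq_or_lt with h | h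
  · simp [← h]
  · simp only [norm_polarPoint hr.1]
    rw [intervalIntegral.integral_mul_const, hc r ⟨h, hr.2⟩]
    have : (Real.pi : ℂ) ≠ 0 := by exact_mod_cast Real.pi_pos.ne'
    push_cast; field_simp

/-! ### Moments -/

lemma ofReal_rpow_mul_le_moment {g : ℝ → ℝ} (hg : AEMeasurable g (volume.restrict (Ico (0 : ℝ) 1)))
    {r x : ℝ} (hr : 0 ≤ r) (hx : 0 ≤ x) :
    ENNReal.ofReal (r ^ x) * radialMeasure g (Ici r) ≤ moment g x := by
  rw [← lintegral_radialMeasure hg, ← setLIntegral_const]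
  calc ∫⁻ _ in Ici r, ENNReal.ofReal (r ^ x) ∂radialMeasure g
      ≤ ∫⁻ s in Ici r, ENNReal.ofReal (s ^ x) ∂radialMeasure g :=
        setLIntegral_mono_ae' measurableSet_Ici (ae_of_all _ fun s hs =>
          ENNReal.ofReal_le_ofReal (Real.rpow_le_rpow hr hs hx))
    _ ≤ _ := setLIntegral_le_lintegral _ _

lemma integral_pow_mul_eq_moment {g : ℝ → ℝ}
    (hg : AEMeasurable g (volume.restrict (Ico (0 : ℝ) 1)))
    (h0 : ∀ r ∈ Ico (0 : ℝ) 1, 0 ≤ g r) (n : ℕ) :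
    ∫ s in Ico (0 : ℝ) 1, s ^ n * g s = (moment g n).toReal := by
  rw [integral_eq_lintegral_of_nonneg_ae]
  · simp only [moment, Real.rpow_natCast]
  · filter_upwards [ae_restrict_mem measurableSet_Ico] with s hs
    exact mul_nonneg (pow_nonneg hs.1 _) (h0 s hs)
  · exact ((by fun_prop : AEMeasurable (fun s : ℝ => s ^ n) _).mul hg).aestronglyMeasurable

lemma lintegral_ofReal_radial {g : ℝ → ℝ}
    (hg : AEMeasurable g (volume.restrict (Ico (0 : ℝ) 1))) :
    ∫⁻ z, ENNReal.ofReal (g ‖z‖) ∂discArea = 2 * moment g 1 := by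
  rw [lintegral_radial hg.ennreal_ofReal, moment, ← lintegral_const_mul' _ _ (by norm_num)]
  refine setLIntegral_congr_fun measurableSet_Ico fun r hr => ?_
  simp only [Real.rpow_one]
  rw [ENNReal.ofReal_mul zero_le_two, ENNReal.ofReal_mul hr.1, ENNReal.ofReal_ofNat, mul_assoc]

lemma norm_mem_Ico {z : ℂ} (hz : z ∈ unitDisc) : ‖z‖ ∈ Ico (0 : ℝ) 1 :=
  ⟨norm_nonneg z, by simpa [unitDisc] using hz⟩

lemma isOpen_unitDisc : IsOpen unitDisc := Metric.isOpen_ball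

lemma mul_conj_mem {z ζ : ℂ} (hz : z ∈ unitDisc) (hζ : ζ ∈ unitDisc) : z * conj ζ ∈ unitDisc := by
  have h1 := norm_mem_Ico hz
  have h2 := norm_mem_Ico hζ
  rw [unitDisc, mem_ball_zero_iff, norm_mul, RCLike.norm_conj]
  nlinarith [h1.1, h1.2, h2.1, h2.2]

lemma aestronglyMeasurable_of_continuousOn {f : ℂ → ℂ} (hf : ContinuousOn f unitDisc) :
    AEStronglyMeasurable f discArea :=
  (hf.aestronglyMeasurable isOpen_unitDisc.measurableSet).smul_measure _

lemma hasSum_of_eq {f g : ℕ → ℂ} {a : ℂ} (h : ∀ n, f n = g n) (hg : HasSum g a) : HasSum f a :=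
  (funext h : f = g) ▸ hg

/-! ### The kernel series -/

/-- The coefficient `1 / (2 ω_{2n+1})`. -/
noncomputable def kerCoeff (ω : ℝ → ℝ) (n : ℕ) : ℝ := (2 * (moment ω (2 * n + 1)).toReal)⁻¹

/-- The series `∑ w^n / (2 ω_{2n+1})`. -/
noncomputable def kerFun (ω : ℝ → ℝ) (w : ℂ) : ℂ := ∑' n, (kerCoeff ω n : ℂ) * w ^ n

/-- The derivative of `kerFun`. -/
noncomputable def kerDeriv (ω : ℝ → ℝ) (w : ℂ) : ℂ :=
  ∑' n : ℕ, (n * kerCoeff ω n : ℂ) * w ^ (n - 1)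

lemma kerCoeff_nonneg (ω : ℝ → ℝ) (n : ℕ) : 0 ≤ kerCoeff ω n := by
  unfold kerCoeff; positivity

section Kernel

variable {ω : ℝ → ℝ}

lemma kerCoeff_mul (hω : IsRadialWeight ω) (n : ℕ) :
    kerCoeff ω n * (2 * (moment ω (2 * n + 1)).toReal) = 1 := by
  refine inv_mul_cancel₀ (mul_ne_zero two_ne_zero (ENNReal.toReal_ne_zero.2 ⟨?_, ?_⟩))
  exacts [hω.moment_ne_zero (by positivity), hω.moment_ne_top (by positivity)]

/-- From ω_{2n+1} ≥ ρ^{2n+1} ω̂(ρ) with ρ² = q strictly between R and 1. It gives the kernel series,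
and its derivative, absolute convergence in the whole disc. -/
lemma exists_kerCoeff_le (hω : IsRadialWeight ω) {R : ℝ} (hR0 : 0 ≤ R) (hR : R < 1) :
    ∃ c q : ℝ, 0 ≤ c ∧ R < q ∧ 0 < q ∧ q < 1 ∧ ∀ n, kerCoeff ω n ≤ c * (q⁻¹) ^ n := by
  set q := (1 + R) / 2 with hq
  have hq0 : 0 < q := by linarith
  have hq1 : q < 1 := by linarith
  set ρ := √q with hρ
  have hρ0 : 0 < ρ := Real.sqrt_pos.2 hq0
  have hρ1 : ρ < 1 := by rw [hρ, Real.sqrt_lt' one_pos]; linarith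
  have hρ2 : ρ ^ 2 = q := Real.sq_sqrt hq0.le
  have ht := hω.tail_pos ρ ⟨hρ0.le, hρ1⟩
  refine ⟨(2 * (ρ * tail ω ρ))⁻¹, q, by positivity, by linarith, hq0, hq1, fun n => ?_⟩
  rw [inv_pow, ← mul_inv, kerCoeff]
  have h1 : ρ ^ (2 * n + 1) * tail ω ρ ≤ (moment ω (2 * n + 1)).toReal := by
    have := ofReal_rpow_mul_le_moment hω.aemeasurable hρ0.le
      (by positivity : (0 : ℝ) ≤ 2 * n + 1)
    rw [← hω.ofReal_tail ⟨hρ0.le, hρ1⟩, ← ENNReal.ofReal_mul (by positivity),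
      ENNReal.ofReal_le_iff_le_toReal (hω.moment_ne_top (by positivity))] at this
    refine le_trans (le_of_eq ?_) this
    rw [← Real.rpow_natCast]; push_cast; rfl
  refine inv_anti₀ (by positivity) ?_
  calc 2 * (ρ * tail ω ρ) * q ^ n = 2 * (ρ ^ (2 * n + 1) * tail ω ρ) := by
        rw [← hρ2]; ring
    _ ≤ _ := by gcongr

lemma summable_kerCoeff (hω : IsRadialWeight ω) {R : ℝ} (hR0 : 0 ≤ R) (hR : R < 1) :
    Summable fun n => kerCoeff ω n * R ^ n := by
  obtain ⟨c, q, hc, hRq, hq0, hq1, h⟩ := exists_kerCoeff_le hω hR0 hR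
  refine Summable.of_nonneg_of_le (fun n => mul_nonneg (kerCoeff_nonneg ω n) (by positivity))
    (fun n => ?_) ((summable_geometric_of_lt_one (r := R / q) (by positivity)
      ((div_lt_one hq0).2 hRq)).mul_left c)
  calc kerCoeff ω n * R ^ n ≤ c * (q⁻¹) ^ n * R ^ n := by gcongr; exact h n
    _ = _ := by rw [div_pow, inv_pow]; ring

lemma summable_mul_kerCoeff (hω : IsRadialWeight ω) {R : ℝ} (hR0 : 0 ≤ R) (hR : R < 1) :
    Summable fun n : ℕ => n * kerCoeff ω n * R ^ (n - 1) := by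
  obtain ⟨c, q, hc, hRq, hq0, hq1, h⟩ := exists_kerCoeff_le hω hR0 hR
  rw [← summable_nat_add_iff 1]
  have hlt : R / q < 1 := (div_lt_one hq0).2 hRq
  have hs : Summable fun n : ℕ => ((n : ℝ) + 1) * (R / q) ^ n := by
    simp only [add_mul, one_mul]
    refine Summable.add ?_ (summable_geometric_of_lt_one (by positivity) hlt)
    simpa using summable_pow_mul_geometric_of_norm_lt_one 1
      (by rwa [Real.norm_of_nonneg (by positivity)] : ‖R / q‖ < 1)
  refine Summable.of_nonneg_of_le (fun n => mul_nonneg (mul_nonneg (by positivity)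
    (kerCoeff_nonneg ω _)) (by positivity)) (fun n => ?_) (hs.mul_left (c * q⁻¹))
  calc ((n + 1 : ℕ) : ℝ) * kerCoeff ω (n + 1) * R ^ (n + 1 - 1)
      ≤ ((n + 1 : ℕ) : ℝ) * (c * (q⁻¹) ^ (n + 1)) * R ^ n := by
        simp only [Nat.add_sub_cancel]
        gcongr; exact h _
    _ = _ := by rw [div_eq_mul_inv, mul_pow]; push_cast; ring

lemma norm_kerCoeff_mul_pow (n : ℕ) (w : ℂ) :
    ‖(kerCoeff ω n : ℂ) * w ^ n‖ = kerCoeff ω n * ‖w‖ ^ n := by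
  rw [norm_mul, norm_pow, Complex.norm_of_nonneg (kerCoeff_nonneg ω n)]

lemma norm_mul_kerCoeff_mul_pow (n : ℕ) (w : ℂ) :
    ‖(n * kerCoeff ω n : ℂ) * w ^ (n - 1)‖ = n * kerCoeff ω n * ‖w‖ ^ (n - 1) := by
  rw [norm_mul, norm_pow, norm_mul, Complex.norm_of_nonneg (kerCoeff_nonneg ω n),
    Complex.norm_natCast]

lemma summable_kerFun (hω : IsRadialWeight ω) {w : ℂ} (hw : ‖w‖ < 1) :
    Summable fun n => (kerCoeff ω n : ℂ) * w ^ n := by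
  refine Summable.of_norm ?_
  simp_rw [norm_kerCoeff_mul_pow]
  exact summable_kerCoeff hω (norm_nonneg w) hw

lemma hasDerivAt_kerFun (hω : IsRadialWeight ω) {w : ℂ} (hw : ‖w‖ < 1) :
    HasDerivAt (kerFun ω) (kerDeriv ω w) w := by
  obtain ⟨R, hwR, hR⟩ := exists_between hw
  have hR0 : 0 < R := (norm_nonneg w).trans_lt hwR
  refine hasDerivAt_tsum_of_isPreconnected (g := fun n y => (kerCoeff ω n : ℂ) * y ^ n)
    (g' := fun n y => (n * kerCoeff ω n : ℂ) * y ^ (n - 1)) (t := Metric.ball 0 R) (y₀ := 0)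
    (summable_mul_kerCoeff hω hR0.le hR) Metric.isOpen_ball
    (convex_ball _ _).isPreconnected (fun n y _ => ?_) (fun n y hy => ?_)
    (Metric.mem_ball_self hR0) (summable_kerFun hω (by simp)) (by simpa using hwR)
  · have := (hasDerivAt_pow n y).const_mul (kerCoeff ω n : ℂ)
    exact this.congr_deriv (by ring)
  · rw [norm_mul_kerCoeff_mul_pow]
    have : ‖y‖ ≤ R := (mem_ball_zero_iff.1 hy).le
    have := kerCoeff_nonneg ω n
    gcongr

lemma norm_kerFun_le (hω : IsRadialWeight ω) {w : ℂ} {R : ℝ} (hw : ‖w‖ ≤ R) (hR : R < 1) :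
    ‖kerFun ω w‖ ≤ ∑' n, kerCoeff ω n * R ^ n := by
  refine tsum_of_norm_bounded (summable_kerCoeff hω ((norm_nonneg w).trans hw) hR).hasSum
    fun n => ?_
  rw [norm_kerCoeff_mul_pow]
  have := kerCoeff_nonneg ω n
  gcongr

lemma norm_kerDeriv_le (hω : IsRadialWeight ω) {w : ℂ} {R : ℝ} (hw : ‖w‖ ≤ R) (hR : R < 1) :
    ‖kerDeriv ω w‖ ≤ ∑' n : ℕ, n * kerCoeff ω n * R ^ (n - 1) := by
  refine tsum_of_norm_bounded (summable_mul_kerCoeff hω ((norm_nonneg w).trans hw) hR).hasSum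
    fun n => ?_
  rw [norm_mul_kerCoeff_mul_pow]
  have := kerCoeff_nonneg ω n
  gcongr

lemma differentiableOn_kerFun (hω : IsRadialWeight ω) : DifferentiableOn ℂ (kerFun ω) unitDisc :=
  fun _ hw => (hasDerivAt_kerFun hω (norm_mem_Ico hw).2).differentiableAt.differentiableWithinAt

lemma continuousOn_kerDeriv (hω : IsRadialWeight ω) : ContinuousOn (kerDeriv ω) unitDisc := by
  refine ((differentiableOn_kerFun hω).deriv isOpen_unitDisc).continuousOn.congr fun w hw => ?_
  exact (hasDerivAt_kerFun hω (norm_mem_Ico hw).2).deriv.symm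

lemma conj_kerFun (w : ℂ) : conj (kerFun ω w) = kerFun ω (conj w) := by
  rw [kerFun, kerFun, Complex.conj_tsum]
  simp

lemma continuousOn_mul_conj {z : ℂ} (hz : z ∈ unitDisc) {f : ℂ → ℂ}
    (hf : ContinuousOn f unitDisc) : ContinuousOn (fun ζ => f (z * conj ζ)) unitDisc :=
  hf.comp (by fun_prop) fun _ hζ => mul_conj_mem hz hζ

lemma norm_mul_conj_le (z : ℂ) {ζ : ℂ} (hζ : ζ ∈ unitDisc) : ‖z * conj ζ‖ ≤ ‖z‖ := by
  rw [norm_mul, RCLike.norm_conj]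
  exact mul_le_of_le_one_right (norm_nonneg z) (norm_mem_Ico hζ).2.le

lemma integrable_mul_kerFun (hω : IsRadialWeight ω) {h : ℂ → ℂ} (hh : Integrable h discArea)
    {z : ℂ} (hz : z ∈ unitDisc) : Integrable (fun ζ => h ζ * kerFun ω (z * conj ζ)) discArea := by
  refine (hh.norm.mul_const (∑' n, kerCoeff ω n * ‖z‖ ^ n)).mono'
    (hh.aestronglyMeasurable.mul (aestronglyMeasurable_of_continuousOn
      (continuousOn_mul_conj hz (differentiableOn_kerFun hω).continuousOn))) ?_
  filter_upwards [ae_mem_unitDisc] with ζ hζ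
  rw [norm_mul]
  gcongr
  exact norm_kerFun_le hω (norm_mul_conj_le z hζ) (norm_mem_Ico hz).2

/-- For fixed z the series of K(z ζ̄) converges uniformly in ζ, so it may be integrated term by term
against any integrable function. This serves both the reproducing formula and the projections of the
test functions. -/
lemma hasSum_integral_mul_kerFun (hω : IsRadialWeight ω) {h : ℂ → ℂ}
    (hh : Integrable h discArea) {z : ℂ} (hz : z ∈ unitDisc) :
    HasSum (fun n => (kerCoeff ω n : ℂ) * z ^ n * ∫ ζ, h ζ * conj ζ ^ n ∂discArea)
      (∫ ζ, h ζ * kerFun ω (z * conj ζ) ∂discArea) := by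
  set F : ℕ → ℂ → ℂ := fun n ζ => h ζ * ((kerCoeff ω n : ℂ) * (z * conj ζ) ^ n)
  have hbound : ∀ n, ∀ᵐ ζ ∂discArea, ‖F n ζ‖ ≤ ‖h ζ‖ * (kerCoeff ω n * ‖z‖ ^ n) := by
    intro n
    filter_upwards [ae_mem_unitDisc] with ζ hζ
    rw [norm_mul, norm_kerCoeff_mul_pow]
    have := kerCoeff_nonneg ω n
    have := norm_mul_conj_le z hζ
    gcongr
  have hF : ∀ n, Integrable (F n) discArea := fun n =>
    (hh.norm.mul_const _).mono' (hh.aestronglyMeasurable.mul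
      (by fun_prop : Continuous _).aestronglyMeasurable) (hbound n)
  have hsum : Summable fun n => ∫ ζ, ‖F n ζ‖ ∂discArea := by
    refine Summable.of_nonneg_of_le (fun n => integral_nonneg fun _ => norm_nonneg _)
      (fun n => ?_) ((summable_kerCoeff hω (norm_nonneg z) (norm_mem_Ico hz).2).mul_left
        (∫ ζ, ‖h ζ‖ ∂discArea))
    rw [← integral_mul_const]
    exact integral_mono_ae (hF n).norm (hh.norm.mul_const _) (hbound n)
  have e1 : ∀ ζ, h ζ * kerFun ω (z * conj ζ) = ∑' n, F n ζ := fun ζ => by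
    simp only [F]
    rw [tsum_mul_left, kerFun]
  simp_rw [e1]
  refine hasSum_of_eq (fun n => ?_) (hasSum_integral_of_summable_integral_norm hF hsum)
  rw [← integral_const_mul]
  congr 1 with ζ
  simp only [F]; ring

end Kernel

/-! ### Circular means -/

lemma integral_polarPoint_pow_mul_conj_pow (n k : ℕ) (r : ℝ) :
    ∫ θ in (-Real.pi)..Real.pi, polarPoint (r, θ) ^ n * conj (polarPoint (r, θ)) ^ k =
      if n = k then 2 * Real.pi * (r : ℂ) ^ (2 * k) else 0 := by
  have h : ∀ θ : ℝ, polarPoint (r, θ) ^ n * conj (polarPoint (r, θ)) ^ k =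
      (r : ℂ) ^ (n + k) * Complex.exp (((n - k : ℤ) : ℂ) * θ * Complex.I) := by
    intro θ
    simp only [polarPoint, map_mul, ← Complex.exp_conj, Complex.conj_ofReal, Complex.conj_I,
      mul_pow, ← Complex.exp_nat_mul]
    rw [mul_mul_mul_comm, ← pow_add, ← Complex.exp_add]
    push_cast; ring_nf
  simp_rw [h]
  rw [intervalIntegral.integral_const_mul, integral_exp_int_mul_I]
  rcases eq_or_ne n k with rfl | hnk
  · simp; ring
  · rw [if_neg hnk, if_neg (by omega)]; simp

lemma integral_tsum_mul_conj_pow {a : ℕ → ℂ} {f : ℂ → ℂ} {r : ℝ} (hr : 0 ≤ r)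
    (ha : Summable fun n => ‖a n‖ * r ^ n)
    (hf : ∀ z : ℂ, ‖z‖ = r → HasSum (fun n => a n * z ^ n) (f z)) (k : ℕ) :
    ∫ θ in (-Real.pi)..Real.pi, f (polarPoint (r, θ)) * conj (polarPoint (r, θ)) ^ k =
      2 * Real.pi * (a k * (r : ℂ) ^ (2 * k)) := by
  have hcont : Continuous fun θ : ℝ => polarPoint (r, θ) := by unfold polarPoint; fun_prop
  have := intervalIntegral.hasSum_integral_of_dominated_convergence (μ := volume)
    (a := -Real.pi) (b := Real.pi)
    (F := fun n θ => a n * (polarPoint (r, θ) ^ n * conj (polarPoint (r, θ)) ^ k))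
    (f := fun θ => f (polarPoint (r, θ)) * conj (polarPoint (r, θ)) ^ k)
    (fun n _ => ‖a n‖ * r ^ n * r ^ k)
    (fun n => (by fun_prop : Continuous _).aestronglyMeasurable)
    (fun n => ae_of_all _ fun θ _ => by
      rw [norm_mul, norm_mul, norm_pow, norm_pow, RCLike.norm_conj, norm_polarPoint hr, mul_assoc])
    (ae_of_all _ fun θ _ => ha.mul_right _) intervalIntegrable_const
    (ae_of_all _ fun θ _ => by
      have := (hf _ (norm_polarPoint hr θ)).mul_right (conj (polarPoint (r, θ)) ^ k)
      simpa only [mul_assoc] using this)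
  refine this.unique ?_
  simp_rw [intervalIntegral.integral_const_mul, integral_polarPoint_pow_mul_conj_pow]
  refine hasSum_of_eq (fun n => ?_)
    (hasSum_ite_eq k (2 * Real.pi * (a k * (r : ℂ) ^ (2 * k))))
  rcases eq_or_ne n k with rfl | hnk
  · simp; ring
  · simp [hnk]

/-! ### The reproducing kernel of `A²_ω` as a power series. -/

section Reproducing

variable {ω : ℝ → ℝ}

lemma enorm_ofReal_radial {g : ℝ → ℝ} (h0 : ∀ r ∈ Ico (0 : ℝ) 1, 0 ≤ g r) {z : ℂ}
    (hz : z ∈ unitDisc) : ‖(g ‖z‖ : ℂ)‖ₑ = ENNReal.ofReal (g ‖z‖) := by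
  rw [← ofReal_norm, Complex.norm_of_nonneg (h0 _ (norm_mem_Ico hz))]

lemma aestronglyMeasurable_radial {g : ℝ → ℝ}
    (hg : AEMeasurable g (volume.restrict (Ico (0 : ℝ) 1))) :
    AEStronglyMeasurable (fun z : ℂ => (g ‖z‖ : ℂ)) discArea :=
  (Complex.measurable_ofReal.comp_aemeasurable
    (hg.comp_quasiMeasurePreserving quasiMeasurePreserving_norm)).aestronglyMeasurable

lemma integrable_radial {g : ℝ → ℝ} (hg : AEMeasurable g (volume.restrict (Ico (0 : ℝ) 1)))
    (h0 : ∀ r ∈ Ico (0 : ℝ) 1, 0 ≤ g r) (h1 : moment g 1 ≠ ∞) :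
    Integrable (fun z : ℂ => (g ‖z‖ : ℂ)) discArea := by
  refine ⟨aestronglyMeasurable_radial hg, ?_⟩
  rw [hasFiniteIntegral_iff_enorm,
    lintegral_congr_ae (ae_mem_unitDisc.mono fun z hz => enorm_ofReal_radial h0 hz),
    lintegral_ofReal_radial hg]
  exact ENNReal.mul_lt_top (by norm_num) h1.lt_top

/-- From |f| ≤ 1 + |f|² and the finiteness of ω dA. -/
lemma integrable_mul_weight (hω : IsRadialWeight ω) {f : ℂ → ℂ} (hf : f ∈ bergmanSpace ω) :
    Integrable (fun z => f z * (ω ‖z‖ : ℂ)) discArea := by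
  have hω' := integrable_radial hω.aemeasurable hω.nonneg (hω.moment_ne_top zero_le_one)
  refine ⟨(aestronglyMeasurable_of_continuousOn hf.1.continuousOn).mul hω'.1, ?_⟩
  rw [hasFiniteIntegral_iff_enorm]
  have h1 : ∫⁻ z, ENNReal.ofReal (ω ‖z‖) ∂discArea < ∞ := by
    rw [lintegral_ofReal_radial hω.aemeasurable]
    exact ENNReal.mul_lt_top (by norm_num) (hω.moment_ne_top zero_le_one).lt_top
  refine lt_of_le_of_lt ?_ (ENNReal.add_lt_top.2 ⟨h1, hf.2⟩)
  have hm : AEMeasurable (fun z : ℂ => ENNReal.ofReal (ω ‖z‖)) discArea :=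
    (hω.aemeasurable.comp_quasiMeasurePreserving quasiMeasurePreserving_norm).ennreal_ofReal
  rw [← lintegral_add_left' hm]
  refine lintegral_mono_ae (ae_mem_unitDisc.mono fun z hz => ?_)
  rw [enorm_mul, enorm_ofReal_radial hω.nonneg hz, ← one_add_mul]
  gcongr
  rcases le_total ‖f z‖ₑ 1 with h | h
  · exact h.trans le_self_add
  · exact (le_self_pow h two_ne_zero).trans le_add_self

/-- On each circle only the k-th Taylor term survives; the radial integral then contributes 2
ω_{2k+1}, which `kerCoeff` inverts. -/
lemma integral_mul_conj_pow_mul_weight (hω : IsRadialWeight ω) {f : ℂ → ℂ}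
    (hf : f ∈ bergmanSpace ω) (k : ℕ) :
    (kerCoeff ω k : ℂ) * ∫ ζ, f ζ * (ω ‖ζ‖ : ℂ) * conj ζ ^ k ∂discArea =
      (k.factorial : ℂ)⁻¹ * iteratedDeriv k f 0 := by
  set a : ℕ → ℂ := fun n => (n.factorial : ℂ)⁻¹ * iteratedDeriv n f 0
  have hdiff : DifferentiableOn ℂ f (Metric.ball 0 1) := hf.1.differentiableOn
  have hsum : ∀ z ∈ unitDisc, HasSum (fun n => a n * z ^ n) (f z) := by
    intro z hz
    have := Complex.hasSum_taylorSeries_on_ball hdiff hz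
    simp only [smul_eq_mul] at this
    refine hasSum_of_eq (fun n => ?_) this
    simp only [a]; ring
  have hint : Integrable (fun ζ => f ζ * conj ζ ^ k * (ω ‖ζ‖ : ℂ)) discArea := by
    have hi := integrable_mul_weight hω hf
    refine hi.norm.mono' ?_ ?_
    · exact ((aestronglyMeasurable_of_continuousOn hf.1.continuousOn).mul
        (by fun_prop : Continuous _).aestronglyMeasurable).mul
        (aestronglyMeasurable_radial hω.aemeasurable)
    · filter_upwards [ae_mem_unitDisc] with ζ hζ
      rw [norm_mul, norm_mul, norm_mul, norm_pow, RCLike.norm_conj]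
      gcongr
      exact mul_le_of_le_one_right (norm_nonneg _)
        (pow_le_one₀ (norm_nonneg _) (norm_mem_Ico hζ).2.le)
  have key := integral_mul_radial hint (c := fun r => a k * (r : ℂ) ^ (2 * k)) fun r hr => by
    refine integral_tsum_mul_conj_pow hr.1.le ?_ (fun z hz => hsum z ?_) k
    · have := (hsum (r : ℂ) (by simpa [unitDisc, abs_of_pos hr.1] using hr.2)).summable.norm
      simpa [abs_of_pos hr.1] using this
    · simpa [unitDisc, hz] using hr.2
  have h2 : ∀ ζ : ℂ, f ζ * (ω ‖ζ‖ : ℂ) * conj ζ ^ k = f ζ * conj ζ ^ k * (ω ‖ζ‖ : ℂ) :=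
    fun ζ => by ring
  have h3 : ∀ r : ℝ, 2 * (r : ℂ) * (a k * (r : ℂ) ^ (2 * k)) * (ω r : ℂ) =
      2 * a k * ((r ^ (2 * k + 1) * ω r : ℝ) : ℂ) := fun r => by push_cast; ring
  simp_rw [h2]
  rw [key]
  simp_rw [h3]
  rw [integral_const_mul, integral_complex_ofReal,
    integral_pow_mul_eq_moment hω.aemeasurable hω.nonneg]
  have h4 := kerCoeff_mul hω k
  push_cast
  calc _ = ((kerCoeff ω k * (2 * (moment ω (2 * k + 1)).toReal) : ℝ) : ℂ) * a k := by
        push_cast; ring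
    _ = a k := by rw [h4]; simp

lemma isReproducingKernel_kerFun (hω : IsRadialWeight ω) :
    IsReproducingKernel ω fun z ζ => kerFun ω (ζ * conj z) := by
  intro z hz
  refine ⟨⟨?_, ?_⟩, fun f hf => ?_⟩
  · refine DifferentiableOn.analyticOnNhd ?_ isOpen_unitDisc
    exact (differentiableOn_kerFun hω).comp (by fun_prop) fun ζ hζ => mul_conj_mem hζ hz
  · set A := ∑' n, kerCoeff ω n * ‖z‖ ^ n
    have hle : ∫⁻ ζ, ‖kerFun ω (ζ * conj z)‖ₑ ^ 2 * ENNReal.ofReal (ω ‖ζ‖) ∂discArea ≤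
        ∫⁻ ζ, ENNReal.ofReal A ^ 2 * ENNReal.ofReal (ω ‖ζ‖) ∂discArea := by
      refine lintegral_mono_ae (ae_mem_unitDisc.mono fun ζ hζ => ?_)
      gcongr
      rw [← ofReal_norm]
      refine ENNReal.ofReal_le_ofReal (norm_kerFun_le hω ?_ (norm_mem_Ico hz).2)
      have := norm_mul_conj_le z hζ
      rw [norm_mul, RCLike.norm_conj] at this ⊢
      rwa [mul_comm]
    refine hle.trans_lt ?_
    rw [lintegral_const_mul' _ _ (by finiteness), lintegral_ofReal_radial hω.aemeasurable]
    exact ENNReal.mul_lt_top (by finiteness)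
      (ENNReal.mul_lt_top (by norm_num) (hω.moment_ne_top zero_le_one).lt_top)
  · have h1 := hasSum_integral_mul_kerFun hω (integrable_mul_weight hω hf) hz
    have h2 := Complex.hasSum_taylorSeries_on_ball (f := f) (c := 0) (r := 1)
      hf.1.differentiableOn hz
    simp only [sub_zero, smul_eq_mul] at h2
    have h3 : ∀ n, (kerCoeff ω n : ℂ) * z ^ n *
        ∫ ζ, f ζ * (ω ‖ζ‖ : ℂ) * conj ζ ^ n ∂discArea =
        (n.factorial : ℂ)⁻¹ * (z ^ n * iteratedDeriv n f 0) := by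
      intro n
      rw [mul_right_comm, integral_mul_conj_pow_mul_weight hω hf n]; ring
    simp_rw [h3] at h1
    rw [h2.unique h1]
    congr 1 with ζ
    rw [conj_kerFun, map_mul, Complex.conj_conj, mul_right_comm, mul_comm (conj ζ)]

/-- Uniqueness of the reproducing kernel, needed because `bergmanKernel` is an arbitrary choice:
with K the power series kernel, B_z(ζ) = ⟨B_z, K_ζ⟩ is the conjugate of ⟨K_ζ, B_z⟩ = K_ζ(z), that
is, K_z(ζ). -/
lemma bergmanKernel_eq (hω : IsRadialWeight ω) {z ζ : ℂ} (hz : z ∈ unitDisc)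
    (hζ : ζ ∈ unitDisc) : bergmanKernel ω z ζ = kerFun ω (ζ * conj z) := by
  have hK := isReproducingKernel_kerFun hω
  have hB : IsReproducingKernel ω (bergmanKernel ω) := Classical.epsilon_spec ⟨_, hK⟩
  have h1 : kerFun ω (z * conj ζ) = _ := (hB z hz).2 _ (hK ζ hζ).1
  have h2 := (hK ζ hζ).2 _ (hB z hz).1
  rw [h2, ← Complex.conj_conj (kerFun ω (ζ * conj z)), conj_kerFun, map_mul, Complex.conj_conj,
    mul_comm (conj ζ) z, h1, ← integral_conj]
  congr 1 with w
  simp only [map_mul, Complex.conj_conj, Complex.conj_ofReal]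
  ring

lemma bergmanProjection_eq (hω : IsRadialWeight ω) (f : ℂ → ℂ) {z : ℂ} (hz : z ∈ unitDisc) :
    (fun ζ => f ζ * conj (bergmanKernel ω z ζ) * (ω ‖ζ‖ : ℂ)) =ᵐ[discArea]
      fun ζ => f ζ * (ω ‖ζ‖ : ℂ) * kerFun ω (z * conj ζ) := by
  filter_upwards [ae_mem_unitDisc] with ζ hζ
  rw [bergmanKernel_eq hω hz hζ, conj_kerFun, map_mul, Complex.conj_conj, mul_right_comm,
    mul_comm (conj ζ)]

end Reproducing

/-! ### Smooth dyadic blocks of the derivative of the kernel -/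

/-- The piecewise linear cutoff, equal to `1` on `(-∞,1]` and to `0` on `[2,∞)`. -/
noncomputable def cutoff (x : ℝ) : ℝ := max 0 (min 1 (2 - x))

lemma cutoff_nonneg (x : ℝ) : 0 ≤ cutoff x := le_max_left _ _

lemma cutoff_le_one (x : ℝ) : cutoff x ≤ 1 := max_le zero_le_one (min_le_left _ _)

lemma cutoff_of_le_one {x : ℝ} (h : x ≤ 1) : cutoff x = 1 := by
  rw [cutoff, min_eq_left (by linarith), max_eq_right zero_le_one]

lemma cutoff_of_two_le {x : ℝ} (h : 2 ≤ x) : cutoff x = 0 :=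
  max_eq_left ((min_le_right _ _).trans (by linarith))

lemma abs_cutoff_sub_le (x y : ℝ) : |cutoff x - cutoff y| ≤ |x - y| := by
  refine (abs_max_sub_max_le_max _ _ _ _).trans ?_
  rw [sub_self, abs_zero]
  refine max_le (abs_nonneg _) ((abs_min_sub_min_le_max _ _ _ _).trans ?_)
  rw [sub_self, abs_zero]
  refine max_le (abs_nonneg _) (le_of_eq ?_)
  rw [show 2 - x - (2 - y) = -(x - y) by ring, abs_neg]

/-- The weight of the frequency `n` in the block at scale `M`. -/
noncomputable def blockWeight (M n : ℕ) : ℝ := cutoff (n / M) - cutoff (2 * n / M)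

lemma abs_blockWeight_le (M n : ℕ) : |blockWeight M n| ≤ 1 := by
  have h1 := cutoff_nonneg (n / M)
  have h2 := cutoff_le_one (n / M)
  have h3 := cutoff_nonneg (2 * n / M)
  have h4 := cutoff_le_one (2 * n / M)
  rw [blockWeight, abs_le]
  constructor <;> linarith

lemma abs_blockWeight_sub_le {M : ℕ} (hM : 0 < M) (n : ℕ) :
    |blockWeight M (n + 1) - blockWeight M n| ≤ 3 / M := by
  have hM' : (0 : ℝ) < M := by exact_mod_cast hM
  have h1 := abs_cutoff_sub_le ((n + 1 : ℕ) / M) (n / M)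
  have h2 := abs_cutoff_sub_le (2 * (n + 1 : ℕ) / M) (2 * n / M)
  have e1 : ((n + 1 : ℕ) : ℝ) / M - n / M = 1 / M := by push_cast; ring
  have e2 : 2 * ((n + 1 : ℕ) : ℝ) / M - 2 * n / M = 2 / M := by push_cast; ring
  rw [e1, abs_of_pos (by positivity : (0 : ℝ) < 1 / M)] at h1
  rw [e2, abs_of_pos (by positivity : (0 : ℝ) < 2 / M)] at h2
  have e3 : (3 : ℝ) / M = 1 / M + 2 / M := by ring
  rw [e3, blockWeight, blockWeight]
  refine le_trans (le_of_eq ?_) ((abs_sub _ _).trans (add_le_add h1 h2))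
  congr 1; ring

lemma blockWeight_of_le {M n : ℕ} (h : 2 * n ≤ M) : blockWeight M n = 0 := by
  rcases M.eq_zero_or_pos with rfl | hM
  · simp [blockWeight]
  have hM' : (0 : ℝ) < M := by exact_mod_cast hM
  have h' : 2 * (n : ℝ) ≤ M := by exact_mod_cast h
  rw [blockWeight, cutoff_of_le_one, cutoff_of_le_one, sub_self]
  · rwa [div_le_one hM']
  · rw [div_le_one hM']; linarith [(Nat.cast_nonneg n : (0 : ℝ) ≤ n)]

lemma blockWeight_of_ge {M n : ℕ} (hM : 0 < M) (h : 2 * M ≤ n) : blockWeight M n = 0 := by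
  have hM' : (0 : ℝ) < M := by exact_mod_cast hM
  have h' : 2 * (M : ℝ) ≤ n := by exact_mod_cast h
  rw [blockWeight, cutoff_of_two_le, cutoff_of_two_le, sub_self]
  · rw [le_div_iff₀ hM']; linarith [(Nat.cast_nonneg n : (0 : ℝ) ≤ n)]
  · rwa [le_div_iff₀ hM']

lemma sum_blockWeight (J n : ℕ) : ∑ j ∈ Finset.range J, blockWeight (2 ^ j) n =
    cutoff (2 * n / 2 ^ J) - cutoff (2 * n) := by
  induction J with
  | zero => simp
  | succ J ih =>
    rw [Finset.sum_range_succ, ih, blockWeight, pow_succ' (2 : ℝ), mul_div_mul_left _ _ two_ne_zero]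
    push_cast; ring

/-- The block at scale `M` of the series `kerDeriv`. -/
noncomputable def kerBlock (ω : ℝ → ℝ) (M : ℕ) (w : ℂ) : ℂ :=
  ∑ n ∈ Finset.range (2 * M), (blockWeight M n : ℂ) * ((n * kerCoeff ω n : ℂ) * w ^ (n - 1))

lemma continuous_kerBlock (ω : ℝ → ℝ) (M : ℕ) : Continuous (kerBlock ω M) := by
  unfold kerBlock; fun_prop

lemma hasSum_kerBlock (ω : ℝ → ℝ) {M : ℕ} (hM : 0 < M) (w : ℂ) :
    HasSum (fun n : ℕ => (blockWeight M n : ℂ) * ((n * kerCoeff ω n : ℂ) * w ^ (n - 1)))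
      (kerBlock ω M w) := by
  refine hasSum_sum_of_ne_finset_zero fun n hn => ?_
  rw [Finset.mem_range, not_lt] at hn
  rw [blockWeight_of_ge hM hn]; simp

section Weight

variable {ω : ℝ → ℝ}

/-- The block weights telescope to a multiplier that is eventually 1 at each n ≥ 1; the term n = 0
is killed by the factor n of the derivative. -/
lemma tendsto_sum_kerBlock (hω : IsRadialWeight ω) {w : ℂ} (hw : ‖w‖ < 1) :
    Tendsto (fun J => ∑ j ∈ Finset.range J, kerBlock ω (2 ^ j) w) atTop (𝓝 (kerDeriv ω w)) := by
  have h1 : ∀ J, ∑ j ∈ Finset.range J, kerBlock ω (2 ^ j) w =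
      ∑' n : ℕ, (∑ j ∈ Finset.range J, (blockWeight (2 ^ j) n : ℂ)) *
        ((n * kerCoeff ω n : ℂ) * w ^ (n - 1)) := by
    intro J
    have := hasSum_sum (s := Finset.range J)
      fun j _ => hasSum_kerBlock ω (M := 2 ^ j) (by positivity) w
    rw [← this.tsum_eq]
    simp_rw [Finset.sum_mul]
  have h2 : ∀ J n : ℕ, ∑ j ∈ Finset.range J, (blockWeight (2 ^ j) n : ℂ) =
      ((cutoff (2 * n / 2 ^ J) - cutoff (2 * n) : ℝ) : ℂ) := by
    intro J n
    rw [← sum_blockWeight]; push_cast; rfl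
  simp_rw [h1, h2, kerDeriv]
  refine tendsto_tsum_of_dominated_convergence
    (summable_mul_kerCoeff hω (norm_nonneg w) hw) (fun n => ?_)
    (Eventually.of_forall fun J n => ?_)
  · rcases n.eq_zero_or_pos with rfl | hn
    · simp
    · refine tendsto_const_nhds.congr' ?_
      have hJ : ∀ᶠ J : ℕ in atTop, 2 * (n : ℝ) ≤ 2 ^ J :=
        (tendsto_pow_atTop_atTop_of_one_lt one_lt_two).eventually_ge_atTop _
      filter_upwards [hJ] with J hJ
      have hn' : (1 : ℝ) ≤ n := by exact_mod_cast hn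
      rw [cutoff_of_le_one ((div_le_one (by positivity)).2 hJ), cutoff_of_two_le (by linarith)]
      simp
  · rw [norm_mul, norm_mul_kerCoeff_mul_pow]
    refine mul_le_of_le_one_left (mul_nonneg (mul_nonneg (Nat.cast_nonneg _)
      (kerCoeff_nonneg ω n)) (by positivity)) ?_
    rw [Complex.norm_real, Real.norm_eq_abs, abs_le]
    constructor <;>
      linarith [cutoff_nonneg (2 * n / 2 ^ J), cutoff_le_one (2 * n / 2 ^ J),
        cutoff_nonneg (2 * n), cutoff_le_one (2 * n)]

lemma enorm_kerDeriv_le (hω : IsRadialWeight ω) {w : ℂ} (hw : ‖w‖ < 1) :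
    ‖kerDeriv ω w‖ₑ ≤ ∑' j : ℕ, ‖kerBlock ω (2 ^ j) w‖ₑ :=
  le_of_tendsto (tendsto_sum_kerBlock hω hw).enorm (Eventually.of_forall fun J =>
    (enorm_sum_le _ _).trans (ENNReal.sum_le_tsum _))

/-! ### Size and variation of the kernel coefficients within a block. -/

lemma succ_mul_pow_mul_one_sub_le {s : ℝ} (h0 : 0 ≤ s) (h1 : s ≤ 1) (n : ℕ) :
    (n + 1) * (s ^ n * (1 - s)) ≤ 1 := by
  have hg := geom_sum_mul_neg s (n + 1)
  have hle : ((n : ℝ) + 1) * s ^ n ≤ ∑ i ∈ Finset.range (n + 1), s ^ i := by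
    have : ∑ _i ∈ Finset.range (n + 1), s ^ n ≤ ∑ i ∈ Finset.range (n + 1), s ^ i :=
      Finset.sum_le_sum fun i hi =>
        pow_le_pow_of_le_one h0 h1 (Nat.lt_succ_iff.1 (Finset.mem_range.1 hi))
    simpa using this
  calc (n + 1) * (s ^ n * (1 - s)) = ((n + 1) * s ^ n) * (1 - s) := by ring
    _ ≤ (∑ i ∈ Finset.range (n + 1), s ^ i) * (1 - s) :=
        mul_le_mul_of_nonneg_right hle (by linarith)
    _ ≤ 1 := by rw [hg]; linarith [pow_nonneg h0 (n + 1)]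

lemma integrableOn_pow_mul (hω : IsRadialWeight ω) (n : ℕ) :
    IntegrableOn (fun s => s ^ n * ω s) (Ico (0 : ℝ) 1) := by
  refine hω.integrableOn.mono'
    ((by fun_prop : AEMeasurable (fun s : ℝ => s ^ n) _).mul hω.aemeasurable).aestronglyMeasurable ?_
  filter_upwards [ae_restrict_mem measurableSet_Ico] with s hs
  rw [Real.norm_of_nonneg (mul_nonneg (pow_nonneg hs.1 _) (hω.nonneg s hs))]
  exact mul_le_of_le_one_left (hω.nonneg s hs) (pow_le_one₀ hs.1 hs.2.le)

/-- Factor s^{2n+1} - s^{2n+3} as s^n · s^{n+1}(1-s) · (1+s). The middle factor gives the gain 1/M,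
and s^n is kept because doubling makes the moments of order n and 2n+1 comparable. -/
lemma moment_sub_le (hω : IsRadialWeight ω) {M n : ℕ} (hM : 0 < M) (h : M ≤ 2 * (n + 1)) :
    (moment ω (2 * n + 1)).toReal - (moment ω (2 * (n + 1 : ℕ) + 1)).toReal ≤
      4 / M * (moment ω n).toReal := by
  have hM' : (0 : ℝ) < M := by exact_mod_cast hM
  have e1 := integral_pow_mul_eq_moment hω.aemeasurable hω.nonneg (2 * n + 1)
  have e2 := integral_pow_mul_eq_moment hω.aemeasurable hω.nonneg (2 * (n + 1) + 1)
  have e3 := integral_pow_mul_eq_moment hω.aemeasurable hω.nonneg n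
  push_cast at e1 e2 e3 ⊢
  rw [← e1, ← e2, ← e3, ← integral_const_mul,
    ← integral_sub (integrableOn_pow_mul hω _) (integrableOn_pow_mul hω _)]
  refine setIntegral_mono_on ((integrableOn_pow_mul hω _).sub (integrableOn_pow_mul hω _))
    ((integrableOn_pow_mul hω _).const_mul _) measurableSet_Ico fun s hs => ?_
  have h1 := succ_mul_pow_mul_one_sub_le hs.1 hs.2.le (n + 1)
  have h2 : s ^ (n + 1) * (1 - s) ≤ 2 / M := by
    rw [le_div_iff₀ hM']
    have h3 : (M : ℝ) ≤ 2 * (n + 1) := by exact_mod_cast h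
    have h4 : 0 ≤ s ^ (n + 1) * (1 - s) :=
      mul_nonneg (pow_nonneg hs.1 _) (by linarith [hs.2])
    push_cast at h1
    nlinarith
  have h5 : 0 ≤ s ^ n * ω s := mul_nonneg (pow_nonneg hs.1 _) (hω.nonneg s hs)
  calc s ^ (2 * n + 1) * ω s - s ^ (2 * (n + 1) + 1) * ω s
      = (s ^ n * ω s) * ((s ^ (n + 1) * (1 - s)) * (1 + s)) := by ring
    _ ≤ (s ^ n * ω s) * ((2 / M) * 2) := by
        gcongr
        · linarith [hs.1]
        · linarith [hs.2]
    _ = 4 / M * (s ^ n * ω s) := by ring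

/-- The tail mass of `ω` at scale `1 / M`, as a real number. -/
noncomputable def scaleMass (ω : ℝ → ℝ) (M : ℕ) : ℝ :=
  (tailMass (radialMeasure ω) (1 / M)).toReal

lemma scaleMass_pos (hω : IsRadialWeight ω) {M : ℕ} (hM : 0 < M) : 0 < scaleMass ω M :=
  ENNReal.toReal_pos (hω.tailMass_pos (by positivity)) (hω.tailMass_ne_top _)

lemma exists_scaleMass_le (hω : IsRadialWeight ω) (hD : UpperDoubling ω) :
    ∃ c : ℝ, 0 < c ∧ ∀ M n : ℕ, 0 < M → n ≤ 2 * M + 2 →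
      scaleMass ω M ≤ c * (moment ω (2 * n + 1)).toReal := by
  obtain ⟨D, hD⟩ := hω.exists_tailDoubling hD
  refine ⟨((D : ℝ) + 1) ^ 3 * 16, by positivity, fun M n hM hn => ?_⟩
  have hM' : (1 : ℝ) ≤ M := by exact_mod_cast hM
  have hn' : (n : ℝ) ≤ 2 * M + 2 := by exact_mod_cast hn
  have h1 := tailMass_le_lintegral_rpow (ae_mem_radialMeasure ω) (x := n + 1 / 2) (by positivity)
  rw [lintegral_radialMeasure hω.aemeasurable,
    show 2 * ((n : ℝ) + 1 / 2) = 2 * n + 1 by ring] at h1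
  have h2 : tailMass (radialMeasure ω) (1 / M) ≤
      (D : ℝ≥0∞) ^ 3 * (16 * moment ω (2 * n + 1)) := by
    -- Three doublings suffice, since n + 5/2 ≤ 2M + 9/2 ≤ 8M.
    calc tailMass (radialMeasure ω) (1 / M)
        = tailMass (radialMeasure ω) (2 ^ 3 * (1 / (8 * M))) := by
          congr 1; field_simp; norm_num
      _ ≤ (D : ℝ≥0∞) ^ 3 * tailMass (radialMeasure ω) (1 / (8 * M)) :=
          hD.pow 3 (by positivity)
      _ ≤ (D : ℝ≥0∞) ^ 3 * tailMass (radialMeasure ω) (1 / (n + 1 / 2 + 2)) := by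
          gcongr
          exact tailMass_mono _ (one_div_le_one_div_of_le (by positivity) (by linarith))
      _ ≤ _ := by gcongr
  have h3 := ENNReal.toReal_mono (by
    have := hω.moment_ne_top (x := 2 * n + 1) (by positivity)
    finiteness) h2
  rw [ENNReal.toReal_mul, ENNReal.toReal_mul, ENNReal.toReal_pow, ENNReal.coe_toReal,
    ENNReal.toReal_ofNat, ← mul_assoc] at h3
  refine h3.trans ?_
  gcongr
  linarith

lemma exists_moment_le_scaleMass (hω : IsRadialWeight ω) (hD : UpperDoubling ω) :
    ∃ K : ℝ, 0 < K ∧ ∀ M : ℕ, ∀ x : ℝ, 0 < M → 0 ≤ x → (M : ℝ) ≤ 8 * (x + 2) →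
      (moment ω x).toReal ≤ K * scaleMass ω M := by
  obtain ⟨D, hD⟩ := hω.exists_tailDoubling hD
  obtain ⟨C, hC⟩ := exists_lintegral_rpow_le (ae_mem_radialMeasure ω) hD
  refine ⟨((C : ℝ) + 1) * ((D : ℝ) + 1) ^ 3, by positivity, fun M x hM hx hMx => ?_⟩
  have hM' : (0 : ℝ) < M := by exact_mod_cast hM
  have h1 := hC x hx
  rw [lintegral_radialMeasure hω.aemeasurable] at h1
  have h2 : moment ω x ≤ C * ((D : ℝ≥0∞) ^ 3 * tailMass (radialMeasure ω) (1 / M)) := by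
    refine h1.trans ?_
    gcongr
    refine le_trans (tailMass_mono _ ?_) (hD.pow 3 (by positivity))
    rw [mul_one_div, div_le_div_iff₀ (by linarith) hM']
    linarith
  have h3 := ENNReal.toReal_mono (by
    have := hω.tailMass_ne_top (1 / M)
    finiteness) h2
  rw [ENNReal.toReal_mul, ENNReal.toReal_mul, ENNReal.toReal_pow, ENNReal.coe_toReal,
    ENNReal.coe_toReal, ← mul_assoc] at h3
  refine h3.trans ?_
  have := ENNReal.toReal_nonneg (a := tailMass (radialMeasure ω) (1 / M))
  rw [scaleMass]
  gcongr <;> linarith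

/-- In the frequency range of the block all the moments involved are comparable to `scaleMass ω M`.
A difference of reciprocals is the difference of the moments divided by their product, so it gains
the factor 1/M of `moment_sub_le`. -/
lemma exists_kerCoeff_bounds (hω : IsRadialWeight ω) (hD : UpperDoubling ω) :
    ∃ Q : ℝ, 0 < Q ∧ ∀ M n : ℕ, 0 < M → M ≤ 2 * (n + 1) → n ≤ 2 * M →
      kerCoeff ω n ≤ Q / scaleMass ω M ∧ kerCoeff ω (n + 1) ≤ Q / scaleMass ω M ∧
      |kerCoeff ω (n + 1) - kerCoeff ω n| ≤ Q / scaleMass ω M / M := by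
  obtain ⟨c, hc, hc'⟩ := exists_scaleMass_le hω hD
  obtain ⟨K, hK, hK'⟩ := exists_moment_le_scaleMass hω hD
  refine ⟨c + 8 * c ^ 2 * K, by positivity, fun M n hM h1 h2 => ?_⟩
  have hM' : (0 : ℝ) < M := by exact_mod_cast hM
  set A := scaleMass ω M with hA
  have hA0 : 0 < A := scaleMass_pos hω hM
  have hk : ∀ l : ℕ, l ≤ 2 * M + 2 → kerCoeff ω l ≤ c / A := by
    intro l hl
    have h3 := hc' M l hM hl
    have h4 := kerCoeff_mul hω l
    have h5 := kerCoeff_nonneg ω l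
    rw [le_div_iff₀ hA0]
    calc kerCoeff ω l * A ≤ kerCoeff ω l * (c * (moment ω (2 * l + 1)).toReal) := by gcongr
      _ = c / 2 * (kerCoeff ω l * (2 * (moment ω (2 * l + 1)).toReal)) := by ring
      _ ≤ c := by rw [h4]; linarith
  have hle : c / A ≤ (c + 8 * c ^ 2 * K) / A := by
    gcongr
    have : 0 ≤ 8 * c ^ 2 * K := by positivity
    linarith
  refine ⟨(hk n (by omega)).trans hle, (hk (n + 1) (by omega)).trans hle, ?_⟩
  set m₁ := (moment ω (2 * n + 1)).toReal with hm₁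
  set m₂ := (moment ω (2 * (n + 1 : ℕ) + 1)).toReal with hm₂
  have e1 : kerCoeff ω n * (2 * m₁) = 1 := kerCoeff_mul hω n
  have e2 : kerCoeff ω (n + 1) * (2 * m₂) = 1 := kerCoeff_mul hω (n + 1)
  have e3 : kerCoeff ω (n + 1) - kerCoeff ω n =
      2 * kerCoeff ω n * kerCoeff ω (n + 1) * (m₁ - m₂) := by
    linear_combination kerCoeff ω n * e2 - kerCoeff ω (n + 1) * e1
  have hdiff : m₁ - m₂ ≤ 4 / M * (K * A) := by
    refine (moment_sub_le hω hM h1).trans ?_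
    gcongr
    refine hK' M n hM (Nat.cast_nonneg n) ?_
    have : (M : ℝ) ≤ 2 * (n + 1) := by exact_mod_cast h1
    linarith [(Nat.cast_nonneg n : (0 : ℝ) ≤ n)]
  have hdiff0 : 0 ≤ m₁ - m₂ := by
    rw [sub_nonneg]
    refine ENNReal.toReal_mono (hω.moment_ne_top (by positivity))
      (moment_anti ω hω.nonneg (by positivity) (by push_cast; linarith))
  have hk0 := kerCoeff_nonneg ω n
  have hk1 := kerCoeff_nonneg ω (n + 1)
  rw [e3, abs_of_nonneg (by positivity)]
  calc 2 * kerCoeff ω n * kerCoeff ω (n + 1) * (m₁ - m₂)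
      ≤ 2 * (c / A) * (c / A) * (4 / M * (K * A)) := by
        gcongr
        · exact hk n (by omega)
        · exact hk (n + 1) (by omega)
    _ = 8 * c ^ 2 * K / A / M := by field_simp; ring
    _ ≤ _ := by gcongr; linarith

/-- The discrete product rule: relative variations, in units of 1/M, add up. -/
lemma abs_mul_sub_mul_le {a a' b b' P Q M s t : ℝ} (ha : |a| ≤ P) (hb' : |b'| ≤ Q)
    (hda : |a' - a| ≤ s * P / M) (hdb : |b' - b| ≤ t * Q / M) :
    |a' * b' - a * b| ≤ (s + t) * (P * Q) / M := by
  calc |a' * b' - a * b| = |(a' - a) * b' + a * (b' - b)| := by congr 1; ring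
    _ ≤ |a' - a| * |b'| + |a| * |b' - b| := by
        rw [← abs_mul, ← abs_mul]; exact abs_add_le _ _
    _ ≤ (s * P / M) * Q + P * (t * Q / M) :=
        add_le_add (mul_le_mul hda hb' (abs_nonneg _) ((abs_nonneg _).trans hda))
          (mul_le_mul ha hdb (abs_nonneg _) ((abs_nonneg _).trans ha))
    _ = _ := by ring

/-- The Fourier coefficients of the block at scale `M` on the circle of radius `ρ`. -/
noncomputable def blockCoeff (ω : ℝ → ℝ) (M : ℕ) (ρ : ℝ) (n : ℕ) : ℝ :=
  blockWeight M n * n * (kerCoeff ω n * ρ ^ (n - 1))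

/-- Only the power 2⌊M/8⌋ is extracted. The exponent d left over satisfies M ≤ 8(d+1), so ρ^d(1-ρ) ≤
8/M yields the increment; the even exponent can later be split into two equal halves. -/
lemma blockCoeff_pow_bounds {M n : ℕ} (hM : 0 < M) (h : M ≤ 2 * (n + 1)) {ρ : ℝ} (h0 : 0 ≤ ρ)
    (h1 : ρ ≤ 1) : ρ ^ (n - 1) ≤ ρ ^ (2 * (M / 8)) ∧ ρ ^ n ≤ ρ ^ (2 * (M / 8)) ∧
      |ρ ^ n - ρ ^ (n - 1)| ≤ 8 * ρ ^ (2 * (M / 8)) / M := by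
  have hM' : (0 : ℝ) < M := by exact_mod_cast hM
  have hle : 2 * (M / 8) ≤ n - 1 := by omega
  refine ⟨pow_le_pow_of_le_one h0 h1 hle, pow_le_pow_of_le_one h0 h1 (by omega), ?_⟩
  rcases n.eq_zero_or_pos with rfl | hn
  · simp; positivity
  · obtain ⟨d, hd⟩ := Nat.exists_eq_add_of_le hle
    have hd' : M ≤ 8 * (d + 1) := by omega
    have hd2 : (M : ℝ) ≤ 8 * (d + 1) := by exact_mod_cast hd'
    have e1 : ρ ^ n = ρ ^ (n - 1) * ρ := by rw [← pow_succ, Nat.sub_add_cancel hn]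
    have e2 : ρ ^ n - ρ ^ (n - 1) = -(ρ ^ (2 * (M / 8)) * (ρ ^ d * (1 - ρ))) := by
      rw [e1, hd, pow_add]; ring
    have h2 := succ_mul_pow_mul_one_sub_le h0 h1 d
    have h3 : 0 ≤ ρ ^ d * (1 - ρ) := mul_nonneg (by positivity) (by linarith)
    have h4 : ρ ^ d * (1 - ρ) ≤ 8 / M := by
      rw [le_div_iff₀ hM']; nlinarith
    rw [e2, abs_neg, abs_of_nonneg (by positivity)]
    calc ρ ^ (2 * (M / 8)) * (ρ ^ d * (1 - ρ)) ≤ ρ ^ (2 * (M / 8)) * (8 / M) := by gcongr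
      _ = _ := by ring

lemma exists_blockCoeff_bounds (hω : IsRadialWeight ω) (hD : UpperDoubling ω) :
    ∃ Q : ℝ, 0 < Q ∧ ∀ (M : ℕ) (ρ : ℝ), 0 < M → 0 ≤ ρ → ρ ≤ 1 → ∀ n : ℕ,
      |blockCoeff ω M ρ n| ≤ Q * M * ρ ^ (2 * (M / 8)) / scaleMass ω M ∧
      |blockCoeff ω M ρ (n + 1) - blockCoeff ω M ρ n| ≤
        4 * (Q * M * ρ ^ (2 * (M / 8)) / scaleMass ω M) / M := by
  obtain ⟨Q, hQ, hQ'⟩ := exists_kerCoeff_bounds hω hD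
  -- The coefficient is a product of four factors, bounded by 3, 3M, Q/A and 8R, with 3 · 3 · 8 =
  -- 72. These bounds are enlarged so that each increment is at most its bound divided by M; four
  -- such factors give the constant 4 in the increment.
  refine ⟨72 * Q, by positivity, fun M ρ hM h0 h1 n => ?_⟩
  have hM' : (1 : ℝ) ≤ M := by exact_mod_cast hM
  have hA := scaleMass_pos hω hM
  by_cases hn : M ≤ 2 * (n + 1) ∧ n ≤ 2 * M
  · obtain ⟨k1, k2, k3⟩ := hQ' M n hM hn.1 hn.2
    obtain ⟨p1, p2, p3⟩ := blockCoeff_pow_bounds hM hn.1 h0 h1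
    set A := scaleMass ω M
    set R := ρ ^ (2 * (M / 8))
    have hR : 0 ≤ R := by positivity
    have hn2 : (n : ℝ) ≤ 2 * M := by exact_mod_cast hn.2
    have a1 : ∀ l, |blockWeight M l| ≤ 3 := fun l => (abs_blockWeight_le M l).trans (by norm_num)
    have a2 : |(n : ℝ)| ≤ 3 * M := by
      rw [abs_of_nonneg (Nat.cast_nonneg n)]; linarith
    have a2' : |((n + 1 : ℕ) : ℝ)| ≤ 3 * M := by
      rw [abs_of_nonneg (Nat.cast_nonneg _)]; push_cast; linarith
    have a3 : |kerCoeff ω n| ≤ Q / A := by rwa [abs_of_nonneg (kerCoeff_nonneg ω n)]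
    have a3' : |kerCoeff ω (n + 1)| ≤ Q / A := by rwa [abs_of_nonneg (kerCoeff_nonneg ω _)]
    have a4 : |ρ ^ (n - 1)| ≤ 8 * R := by rw [abs_of_nonneg (by positivity)]; linarith
    have a4' : |ρ ^ (n + 1 - 1)| ≤ 8 * R := by
      rw [abs_of_nonneg (by positivity), Nat.add_sub_cancel]; linarith
    have m1 : ∀ l : ℕ, |(l : ℝ)| ≤ 3 * M → |blockWeight M l * l| ≤ 3 * (3 * M) := fun l hl => by
      rw [abs_mul]; exact mul_le_mul (a1 l) hl (abs_nonneg _) (by norm_num)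
    have m2 : |kerCoeff ω n * ρ ^ (n - 1)| ≤ Q / A * (8 * R) := by
      rw [abs_mul]; exact mul_le_mul a3 a4 (abs_nonneg _) (by positivity)
    have m2' : |kerCoeff ω (n + 1) * ρ ^ (n + 1 - 1)| ≤ Q / A * (8 * R) := by
      rw [abs_mul]; exact mul_le_mul a3' a4' (abs_nonneg _) (by positivity)
    have d1 := abs_mul_sub_mul_le (M := M) (s := 1) (t := 1) (a := blockWeight M n)
      (a' := blockWeight M (n + 1)) (b := n) (b' := (n + 1 : ℕ)) (a1 n) a2'
      (by rw [one_mul]; exact abs_blockWeight_sub_le hM n)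
      (by push_cast
          rw [add_sub_cancel_left, abs_one, le_div_iff₀ (by linarith)]; linarith)
    have d2 := abs_mul_sub_mul_le (M := M) (s := 1) (t := 1) a3 a4'
      (by rw [one_mul]; exact k3) (by rw [one_mul]; exact p3)
    have d := abs_mul_sub_mul_le (m1 n a2) m2' d1 d2
    refine ⟨?_, ?_⟩
    · rw [blockCoeff, abs_mul]
      refine (mul_le_mul (m1 n a2) m2 (abs_nonneg _) (by positivity)).trans (le_of_eq ?_)
      ring
    · rw [blockCoeff, blockCoeff]
      refine d.trans (le_of_eq ?_)
      ring
  -- The range above includes one index before the support of the weight, so that outside it both n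
  -- and n + 1 miss the support.
  · have hz : blockWeight M n = 0 ∧ blockWeight M (n + 1) = 0 := by
      rcases not_and_or.1 hn with h | h
      · exact ⟨blockWeight_of_le (by omega), blockWeight_of_le (by omega)⟩
      · exact ⟨blockWeight_of_ge hM (by omega), blockWeight_of_ge hM (by omega)⟩
    simp only [blockCoeff, hz.1, hz.2, zero_mul, sub_zero, abs_zero]
    constructor <;> positivity

lemma norm_kerBlock_eq (ω : ℝ → ℝ) (M : ℕ) (ρ θ : ℝ) :
    ‖kerBlock ω M (ρ * Complex.exp (θ * Complex.I))‖ =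
      ‖trigPoly (blockCoeff ω M ρ) (2 * M) θ‖ := by
  have : trigPoly (blockCoeff ω M ρ) (2 * M) θ =
      Complex.exp (θ * Complex.I) * kerBlock ω M (ρ * Complex.exp (θ * Complex.I)) := by
    rw [trigPoly, kerBlock, Finset.mul_sum]
    refine Finset.sum_congr rfl fun n _ => ?_
    rcases n.eq_zero_or_pos with rfl | hn
    · simp [blockCoeff]
    · obtain ⟨l, rfl⟩ := Nat.exists_eq_add_of_le' hn
      rw [mul_assoc, Complex.exp_nat_mul, Nat.add_sub_cancel, blockCoeff, Nat.add_sub_cancel,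
        mul_pow, pow_succ]
      push_cast; ring
  rw [this, norm_mul, Complex.norm_exp_ofReal_mul_I, one_mul]

/-- By periodicity the mean over the circle depends on z only through |z|, and the Carlson type
inequality applies with L = 2M coefficients. -/
lemma exists_lintegral_kerBlock_le (hω : IsRadialWeight ω) (hD : UpperDoubling ω) :
    ∃ Q : ℝ, 0 < Q ∧ ∀ (M : ℕ) (z : ℂ) (r : ℝ), 0 < M → z ∈ unitDisc → r ∈ Ico (0 : ℝ) 1 →
      ∫⁻ θ in Ioo (-Real.pi) Real.pi, ‖kerBlock ω M (z * conj (polarPoint (r, θ)))‖ₑ ≤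
        ENNReal.ofReal (Q * M * (‖z‖ * r) ^ (2 * (M / 8)) / scaleMass ω M) := by
  obtain ⟨Q, hQ, hQ'⟩ := exists_blockCoeff_bounds hω hD
  refine ⟨52 * Real.pi * Q, by positivity, fun M z r hM hz hr => ?_⟩
  have hM' : (1 : ℝ) ≤ M := by exact_mod_cast hM
  have hA := scaleMass_pos hω hM
  have hz' := norm_mem_Ico hz
  set ρ := ‖z‖ * r with hρ
  have hρ0 : 0 ≤ ρ := mul_nonneg hz'.1 hr.1
  have hρ1 : ρ ≤ 1 := mul_le_one₀ hz'.2.le hr.1 hr.2.le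
  set f : ℝ → ℝ := fun θ => ‖kerBlock ω M (ρ * Complex.exp (θ * Complex.I))‖ with hf
  have hfc : Continuous f := by
    have := continuous_kerBlock ω M
    fun_prop
  have hper : Function.Periodic f (2 * Real.pi) := by
    intro θ
    simp only [hf]
    congr 3
    push_cast
    rw [add_mul, Complex.exp_add, Complex.exp_two_pi_mul_I, mul_one]
  have hpt : ∀ θ : ℝ, ‖kerBlock ω M (z * conj (polarPoint (r, θ)))‖ = f (z.arg - θ) := by
    intro θ
    simp only [hf]
    congr 2
    conv_lhs => rw [← Complex.norm_mul_exp_arg_mul_I z]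
    simp only [polarPoint, map_mul, Complex.conj_ofReal, ← Complex.exp_conj, Complex.conj_I]
    rw [mul_mul_mul_comm, ← Complex.exp_add, hρ]
    push_cast; ring_nf
  have hint : ∫ θ in (-Real.pi)..Real.pi, f (z.arg - θ) =
      ∫ θ in (-Real.pi)..Real.pi, f θ := by
    rw [intervalIntegral.integral_comp_sub_left]
    have := hper.intervalIntegral_add_eq (z.arg - Real.pi) (-Real.pi)
    convert this using 2 <;> ring
  have hbound : ∫ θ in (-Real.pi)..Real.pi, f θ ≤
      52 * Real.pi * (Q * M * ρ ^ (2 * (M / 8)) / scaleMass ω M) := by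
    simp only [hf, norm_kerBlock_eq]
    refine integral_norm_trigPoly_le (M := M) (by linarith) (by positivity) ?_ ?_ ?_
      (fun n => (hQ' M ρ hM hρ0 hρ1 n).1) (fun n => (hQ' M ρ hM hρ0 hρ1 n).2)
    · simp [blockCoeff]
    · simp [blockCoeff, blockWeight_of_ge hM le_rfl]
    · push_cast; linarith
  have hle : ∫⁻ θ in Ioo (-Real.pi) Real.pi, ‖kerBlock ω M (z * conj (polarPoint (r, θ)))‖ₑ =
      ENNReal.ofReal (∫ θ in (-Real.pi)..Real.pi, f (z.arg - θ)) := by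
    have hc : Continuous fun θ => f (z.arg - θ) := by fun_prop
    rw [intervalIntegral.integral_of_le (by linarith [Real.pi_pos]),
      integral_Ioc_eq_integral_Ioo, ofReal_integral_eq_lintegral_ofReal
        ((hc.integrableOn_Icc (a := -Real.pi) (b := Real.pi)).mono_set Ioo_subset_Icc_self)
        (ae_of_all _ fun θ => norm_nonneg _)]
    refine lintegral_congr fun θ => ?_
    rw [← hpt, ofReal_norm]
  rw [hle, hint]
  refine ENNReal.ofReal_le_ofReal (hbound.trans (le_of_eq ?_))
  ring

end Weight

/-! ### The moment condition implies boundedness -/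

/-- Cauchy condensation of the geometric series, after a shift by three indices to absorb the
division by 8. The first three terms have exponent 0 and add up to 7, the rest to at most 8 · 3
times (1-t)⁻¹. -/
lemma tsum_two_pow_mul_pow_le (t : ℝ≥0∞) (ht : t ≤ 1) :
    ∑' j : ℕ, 2 ^ j * t ^ (2 ^ j / 8) ≤ 31 * (1 - t)⁻¹ := by
  have hone : 1 ≤ (1 - t)⁻¹ := ENNReal.one_le_inv.2 tsub_le_self
  have h1 : ∑' j : ℕ, 2 ^ j * t ^ (2 ^ j) ≤ 3 * (1 - t)⁻¹ := by
    refine (ENNReal.tsum_condensed_le (f := fun n => t ^ n) fun m n _ hmn =>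
      pow_le_pow_right_of_le_one' ht hmn).trans ?_
    rw [ENNReal.tsum_geometric, pow_one, show (3 : ℝ≥0∞) = 1 + 2 by norm_num, add_mul, one_mul]
    gcongr
    exact ht.trans hone
  set f : ℕ → ℝ≥0∞ := fun j => 2 ^ j * t ^ (2 ^ j / 8) with hf
  have h2 : ∀ j : ℕ, f (j + 3) = 8 * (2 ^ j * t ^ (2 ^ j)) := by
    intro j
    have : 2 ^ (j + 3) / 8 = 2 ^ j := by rw [pow_add]; norm_num
    simp only [hf]
    rw [this, pow_add]; ring
  have h3 : ∑ j ∈ Finset.range 3, f j ≤ 7 * 1 := by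
    simp [hf, Finset.sum_range_succ]; norm_num
  have h4 := Summable.sum_add_tsum_nat_add' (f := f) (k := 3) ENNReal.summable
  rw [tsum_congr h2, ENNReal.tsum_mul_left] at h4
  calc ∑' j, f j = _ := h4.symm
    _ ≤ 7 * (1 - t)⁻¹ + 8 * (3 * (1 - t)⁻¹) := by gcongr; exact h3.trans (by gcongr)
    _ = _ := by ring

section Bounded

variable {ν ω : ℝ → ℝ}

lemma MomentCondition.exists_moment_mul_le (hω : IsRadialWeight ω) (h : MomentCondition ω ν) :
    ∃ S : ℝ≥0, ∀ x : ℝ, 0 ≤ x →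
      moment ν x * moment (fun s => ω s / tail ν s) x ≤ S * moment ω (2 * x) := by
  lift (⨆ x ∈ Ici (0 : ℝ), moment ν x / moment ω (2 * x) * moment (fun s => ω s / tail ν s) x)
    to ℝ≥0 using LT.lt.ne h with S hS
  refine ⟨S, fun x hx => ?_⟩
  have h1 := le_iSup₂ (f := fun (x : ℝ) (_ : x ∈ Ici (0 : ℝ)) =>
    moment ν x / moment ω (2 * x) * moment (fun s => ω s / tail ν s) x) x hx
  rw [hS]
  refine le_trans (le_of_eq ?_) (mul_le_mul_left h1 (moment ω (2 * x)))
  rw [mul_right_comm, ENNReal.div_mul_cancel (hω.moment_ne_zero (by positivity))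
    (hω.moment_ne_top (by positivity))]

lemma MomentCondition.moment_quotient_ne_top (hν : IsRadialWeight ν) (hω : IsRadialWeight ω)
    (h : MomentCondition ω ν) {x : ℝ} (hx : 0 ≤ x) :
    moment (fun s => ω s / tail ν s) x ≠ ∞ := by
  obtain ⟨S, hS⟩ := h.exists_moment_mul_le hω
  have h1 := hS x hx
  intro h0
  rw [h0, ENNReal.mul_top (hν.moment_ne_zero hx), top_le_iff] at h1
  exact ENNReal.mul_ne_top ENNReal.coe_ne_top (hω.moment_ne_top (by positivity)) h1

/-- The core of sufficiency. The moment condition is used block by block at x = ⌊2^j/8⌋, which is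
why no regularity of ν is needed. -/
lemma exists_kerDeriv_mean_le (hν : IsRadialWeight ν) (hω : IsRadialWeight ω)
    (hD : UpperDoubling ω) (h : MomentCondition ω ν) :
    ∃ C : ℝ≥0, ∀ z ∈ unitDisc, ENNReal.ofReal ((1 - ‖z‖) * tail ν ‖z‖) *
      ∫⁻ ζ, ‖kerDeriv ω (z * conj ζ)‖ₑ * ENNReal.ofReal (ω ‖ζ‖ / tail ν ‖ζ‖) ∂discArea ≤ C := by
  obtain ⟨S, hS⟩ := h.exists_moment_mul_le hω
  obtain ⟨Q, hQ, hQ'⟩ := exists_lintegral_kerBlock_le hω hD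
  obtain ⟨K, hK, hK'⟩ := exists_moment_le_scaleMass hω hD
  set g : ℝ → ℝ := fun s => ω s / tail ν s with hg
  have hgm : AEMeasurable g (volume.restrict (Ico (0 : ℝ) 1)) := aemeasurable_quotient hν hω
  have hg0 := quotient_nonneg hν hω
  refine ⟨31 * (Q.toNNReal * S * K.toNNReal), fun z hz => ?_⟩
  have hz' := norm_mem_Ico hz
  set t : ℝ≥0∞ := ENNReal.ofReal ‖z‖ with ht
  have ht1 : t < 1 := ENNReal.ofReal_lt_one.2 hz'.2
  set T : ℝ≥0∞ := ENNReal.ofReal (tail ν ‖z‖) with hT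
  have hblock : ∀ j : ℕ, ∫⁻ ζ, ‖kerBlock ω (2 ^ j) (z * conj ζ)‖ₑ * ENNReal.ofReal (g ‖ζ‖)
      ∂discArea ≤ ENNReal.ofReal (Q * 2 ^ j * ‖z‖ ^ (2 * (2 ^ j / 8)) / scaleMass ω (2 ^ j)) *
        moment g (2 * (2 ^ j / 8 : ℕ)) := by
    intro j
    have hA := scaleMass_pos hω (M := 2 ^ j) (by positivity)
    have hmeas : Measurable fun ζ => ‖kerBlock ω (2 ^ j) (z * conj ζ)‖ₑ :=
      ((continuous_kerBlock ω (2 ^ j)).comp (by fun_prop)).enorm.measurable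
    rw [lintegral_mul_radial hmeas hgm.ennreal_ofReal, moment,
      ← lintegral_const_mul' _ _ ENNReal.ofReal_ne_top]
    refine setLIntegral_mono_ae' measurableSet_Ico (ae_of_all _ fun r hr => ?_)
    have hrpow : r ^ (2 * ((2 ^ j / 8 : ℕ) : ℝ)) = r ^ (2 * (2 ^ j / 8)) := by
      rw [← Real.rpow_natCast]; push_cast; rfl
    -- The Jacobian is simply discarded.
    have hr1 : ENNReal.ofReal (r / Real.pi) ≤ 1 := by
      rw [ENNReal.ofReal_le_one, div_le_one Real.pi_pos]
      linarith [hr.2, Real.pi_gt_three]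
    calc _ ≤ 1 * ENNReal.ofReal (Q * (2 ^ j : ℕ) * (‖z‖ * r) ^ (2 * (2 ^ j / 8)) /
            scaleMass ω (2 ^ j)) * ENNReal.ofReal (g r) := by
          gcongr
          exact hQ' (2 ^ j) z r (by positivity) hz hr
      _ = _ := by
          have hr0 := hr.1
          rw [one_mul, ← ENNReal.ofReal_mul (by positivity), ← ENNReal.ofReal_mul (by positivity),
            hrpow, mul_pow]
          congr 1; push_cast; ring
  have hterm : ∀ j : ℕ, T * (ENNReal.ofReal (Q * 2 ^ j * ‖z‖ ^ (2 * (2 ^ j / 8)) /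
      scaleMass ω (2 ^ j)) * moment g (2 * (2 ^ j / 8 : ℕ))) ≤
      (Q.toNNReal * S * K.toNNReal) * (2 ^ j * t ^ (2 ^ j / 8)) := by
    intro j
    have hA := scaleMass_pos hω (M := 2 ^ j) (by positivity)
    set A := scaleMass ω (2 ^ j)
    set m : ℕ := 2 ^ j / 8 with hm
    -- One half of |z|^{2m} is spent on turning ν̂(z) into a moment of ν; the other half is kept for
    -- the sum over j.
    have h1 : t ^ m * T ≤ moment ν m := by
      have := ofReal_rpow_mul_le_moment hν.aemeasurable hz'.1 (Nat.cast_nonneg m)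
      rwa [← hν.ofReal_tail hz', Real.rpow_natCast, ENNReal.ofReal_pow hz'.1] at this
    have h2 : moment g (2 * m) ≤ moment g m :=
      moment_anti g hg0 (Nat.cast_nonneg m) (by linarith [(Nat.cast_nonneg m : (0 : ℝ) ≤ m)])
    have h3 : moment ω (2 * m) ≤ ENNReal.ofReal (K * A) := by
      rw [← ENNReal.ofReal_toReal (hω.moment_ne_top (by positivity : (0 : ℝ) ≤ 2 * m))]
      refine ENNReal.ofReal_le_ofReal (hK' (2 ^ j) _ (by positivity) (by positivity) ?_)
      have : 2 ^ j ≤ 8 * (2 * m + 2) := by omega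
      exact_mod_cast this
    have h4 : ENNReal.ofReal (Q * 2 ^ j * ‖z‖ ^ (2 * m) / A) =
        ENNReal.ofReal (Q * 2 ^ j / A) * t ^ m * t ^ m := by
      rw [mul_assoc _ (t ^ m), ← pow_add, ht, ← ENNReal.ofReal_pow hz'.1,
        ← ENNReal.ofReal_mul (by positivity)]
      congr 1; ring_nf
    calc T * (ENNReal.ofReal (Q * 2 ^ j * ‖z‖ ^ (2 * m) / A) * moment g (2 * m))
        = ENNReal.ofReal (Q * 2 ^ j / A) * t ^ m * ((t ^ m * T) * moment g (2 * m)) := by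
          rw [h4]; ring
      _ ≤ ENNReal.ofReal (Q * 2 ^ j / A) * t ^ m * (S * ENNReal.ofReal (K * A)) := by
          refine mul_le_mul_right ?_ _
          calc (t ^ m * T) * moment g (2 * m) ≤ moment ν m * moment g m := by gcongr
            _ ≤ S * moment ω (2 * m) := hS m (Nat.cast_nonneg m)
            _ ≤ _ := by gcongr
      _ = S * t ^ m * (ENNReal.ofReal (Q * 2 ^ j / A) * ENNReal.ofReal (K * A)) := by ring
      _ = S * t ^ m * (ENNReal.ofReal Q * 2 ^ j * ENNReal.ofReal K) := by
          rw [← ENNReal.ofReal_mul (by positivity),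
            show Q * 2 ^ j / A * (K * A) = Q * 2 ^ j * K by field_simp,
            ENNReal.ofReal_mul (by positivity), ENNReal.ofReal_mul hQ.le,
            ENNReal.ofReal_pow zero_le_two, ENNReal.ofReal_ofNat]
      _ = _ := by simp only [ENNReal.ofReal]; ring
  have hmeasj : ∀ j : ℕ, AEMeasurable (fun ζ => ‖kerBlock ω (2 ^ j) (z * conj ζ)‖ₑ *
      ENNReal.ofReal (g ‖ζ‖)) discArea := fun j => by
    refine AEMeasurable.mul ?_
      (hgm.comp_quasiMeasurePreserving quasiMeasurePreserving_norm).ennreal_ofReal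
    exact ((continuous_kerBlock ω (2 ^ j)).comp (by fun_prop)).enorm.measurable.aemeasurable
  have hI : ∫⁻ ζ, ‖kerDeriv ω (z * conj ζ)‖ₑ * ENNReal.ofReal (g ‖ζ‖) ∂discArea ≤
      ∑' j : ℕ, ENNReal.ofReal (Q * 2 ^ j * ‖z‖ ^ (2 * (2 ^ j / 8)) / scaleMass ω (2 ^ j)) *
        moment g (2 * (2 ^ j / 8 : ℕ)) := by
    calc _ ≤ ∫⁻ ζ, ∑' j : ℕ, ‖kerBlock ω (2 ^ j) (z * conj ζ)‖ₑ * ENNReal.ofReal (g ‖ζ‖)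
            ∂discArea := by
          refine lintegral_mono_ae (ae_mem_unitDisc.mono fun ζ hζ => ?_)
          rw [ENNReal.tsum_mul_right]
          gcongr
          exact enorm_kerDeriv_le hω (norm_mem_Ico (mul_conj_mem hz hζ)).2
      _ = ∑' j : ℕ, ∫⁻ ζ, ‖kerBlock ω (2 ^ j) (z * conj ζ)‖ₑ * ENNReal.ofReal (g ‖ζ‖)
            ∂discArea := lintegral_tsum hmeasj
      _ ≤ _ := ENNReal.tsum_le_tsum hblock
  have h1t : ENNReal.ofReal (1 - ‖z‖) = 1 - t := by
    rw [ENNReal.ofReal_sub _ hz'.1, ENNReal.ofReal_one]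
  rw [ENNReal.ofReal_mul (by linarith [hz'.2]), h1t, mul_assoc]
  refine (mul_le_mul_right (mul_le_mul_right hI _) _).trans ?_
  calc (1 - t) * (T * ∑' j : ℕ, ENNReal.ofReal (Q * 2 ^ j * ‖z‖ ^ (2 * (2 ^ j / 8)) /
      scaleMass ω (2 ^ j)) * moment g (2 * (2 ^ j / 8 : ℕ)))
      = (1 - t) * ∑' j : ℕ, T * (ENNReal.ofReal (Q * 2 ^ j * ‖z‖ ^ (2 * (2 ^ j / 8)) /
      scaleMass ω (2 ^ j)) * moment g (2 * (2 ^ j / 8 : ℕ))) := by rw [ENNReal.tsum_mul_left]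
    _ ≤ (1 - t) * ∑' j : ℕ, (Q.toNNReal * S * K.toNNReal) * (2 ^ j * t ^ (2 ^ j / 8)) :=
        mul_le_mul_right (ENNReal.tsum_le_tsum hterm) _
    _ ≤ (1 - t) * ((Q.toNNReal * S * K.toNNReal) * (31 * (1 - t)⁻¹)) := by
        rw [ENNReal.tsum_mul_left]
        gcongr
        exact tsum_two_pow_mul_pow_le t ht1.le
    _ = 31 * (Q.toNNReal * S * K.toNNReal) * ((1 - t) * (1 - t)⁻¹) := by ring
    _ = _ := by
        rw [ENNReal.mul_inv_cancel (tsub_pos_of_lt ht1).ne' (by finiteness), mul_one]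
        push_cast; rfl

/-! ### The derivative of the projection. -/

lemma hasDerivAt_integral_mul_kerFun (hω : IsRadialWeight ω) {h : ℂ → ℂ}
    (hh : Integrable h discArea) {z : ℂ} (hz : z ∈ unitDisc) :
    HasDerivAt (fun z => ∫ ζ, h ζ * kerFun ω (z * conj ζ) ∂discArea)
      (∫ ζ, h ζ * (kerDeriv ω (z * conj ζ) * conj ζ) ∂discArea) z := by
  obtain ⟨R, hzR, hR⟩ := exists_between (norm_mem_Ico hz).2
  have hball : ∀ w ∈ Metric.ball (0 : ℂ) R, w ∈ unitDisc := fun w hw =>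
    Metric.ball_subset_ball hR.le hw
  refine (hasDerivAt_integral_of_dominated_loc_of_deriv_le
    (F := fun z ζ => h ζ * kerFun ω (z * conj ζ))
    (F' := fun z ζ => h ζ * (kerDeriv ω (z * conj ζ) * conj ζ)) (s := Metric.ball (0 : ℂ) R)
    (𝕜 := ℂ) (bound := fun ζ => ‖h ζ‖ * ∑' n : ℕ, (n * kerCoeff ω n * R ^ (n - 1) : ℝ))
    (Metric.isOpen_ball.mem_nhds (by simpa using hzR)) ?_ (integrable_mul_kerFun hω hh hz) ?_ ?_
    (hh.norm.mul_const _) ?_).2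
  · filter_upwards [isOpen_unitDisc.mem_nhds hz] with w hw
    exact (integrable_mul_kerFun hω hh hw).aestronglyMeasurable
  · exact hh.aestronglyMeasurable.mul (aestronglyMeasurable_of_continuousOn
      ((continuousOn_mul_conj hz (continuousOn_kerDeriv hω)).mul (by fun_prop)))
  · filter_upwards [ae_mem_unitDisc] with ζ hζ w hw
    rw [norm_mul, norm_mul, RCLike.norm_conj]
    have h1 : ‖w * conj ζ‖ ≤ R :=
      (norm_mul_conj_le w hζ).trans (mem_ball_zero_iff.1 hw).le
    gcongr
    exact (mul_le_of_le_one_right (norm_nonneg _) (norm_mem_Ico hζ).2.le).trans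
      (norm_kerDeriv_le hω h1 hR)
  · filter_upwards [ae_mem_unitDisc] with ζ hζ w hw
    have h1 := hasDerivAt_kerFun hω (norm_mem_Ico (mul_conj_mem (hball w hw) hζ)).2
    have h2 : HasDerivAt (fun w => w * conj ζ) (conj ζ) w := by
      simpa using (hasDerivAt_id w).mul_const (conj ζ)
    exact (h1.comp w h2).const_mul (h ζ)

lemma projectionDefined_of_integrable (hω : IsRadialWeight ω) {f : ℂ → ℂ}
    (hf : Integrable (fun ζ => f ζ * (ω ‖ζ‖ : ℂ)) discArea) : ProjectionDefined ω f :=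
  fun _ hz => (integrable_congr (bergmanProjection_eq hω f hz)).2 (integrable_mul_kerFun hω hf hz)

lemma hasDerivAt_bergmanProjection (hω : IsRadialWeight ω) {f : ℂ → ℂ}
    (hf : Integrable (fun ζ => f ζ * (ω ‖ζ‖ : ℂ)) discArea) {z : ℂ} (hz : z ∈ unitDisc) :
    HasDerivAt (bergmanProjection ω f)
      (∫ ζ, f ζ * (ω ‖ζ‖ : ℂ) * (kerDeriv ω (z * conj ζ) * conj ζ) ∂discArea) z := by
  refine (hasDerivAt_integral_mul_kerFun hω hf hz).congr_of_eventuallyEq ?_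
  filter_upwards [isOpen_unitDisc.mem_nhds hz] with w hw
  exact integral_congr_ae (bergmanProjection_eq hω f hw)

lemma ae_enorm_mul_weight_le (hν : IsRadialWeight ν) (hω : IsRadialWeight ω) (f : ℂ → ℂ) :
    ∀ᵐ ζ ∂discArea, ‖f ζ * (ω ‖ζ‖ : ℂ)‖ₑ ≤
      growthNorm (tail ν) f * ENNReal.ofReal (ω ‖ζ‖ / tail ν ‖ζ‖) := by
  filter_upwards [ae_mem_unitDisc, ENNReal.ae_le_essSup
    fun z : ℂ => ‖f z‖ₑ * ENNReal.ofReal (tail ν ‖z‖)] with ζ hζ h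
  have hζ' := norm_mem_Ico hζ
  have ht := hν.tail_pos _ hζ'
  rw [enorm_mul, enorm_ofReal_radial hω.nonneg hζ]
  calc ‖f ζ‖ₑ * ENNReal.ofReal (ω ‖ζ‖)
      = ‖f ζ‖ₑ * ENNReal.ofReal (tail ν ‖ζ‖) * ENNReal.ofReal (ω ‖ζ‖ / tail ν ‖ζ‖) := by
        rw [mul_assoc, ← ENNReal.ofReal_mul ht.le, mul_div_cancel₀ _ ht.ne']
    _ ≤ _ := by gcongr; exact h

lemma integrable_mul_weight_of_mem_growthSpace (hν : IsRadialWeight ν) (hω : IsRadialWeight ω)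
    (hg : moment (fun s => ω s / tail ν s) 1 ≠ ∞) {f : ℂ → ℂ} (hf : f ∈ growthSpace (tail ν)) :
    Integrable (fun ζ => f ζ * (ω ‖ζ‖ : ℂ)) discArea := by
  refine ⟨hf.1.mul (aestronglyMeasurable_radial hω.aemeasurable), ?_⟩
  rw [hasFiniteIntegral_iff_enorm]
  refine (lintegral_mono_ae (ae_enorm_mul_weight_le hν hω f)).trans_lt ?_
  rw [lintegral_const_mul' _ _ hf.2.ne]
  refine ENNReal.mul_lt_top hf.2 ?_
  rw [lintegral_ofReal_radial (aemeasurable_quotient hν hω)]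
  exact ENNReal.mul_lt_top (by norm_num) hg.lt_top

lemma enorm_deriv_bergmanProjection_le (hν : IsRadialWeight ν) (hω : IsRadialWeight ω)
    {f : ℂ → ℂ} (hf : f ∈ growthSpace (tail ν))
    (hfi : Integrable (fun ζ => f ζ * (ω ‖ζ‖ : ℂ)) discArea) {z : ℂ} (hz : z ∈ unitDisc) :
    ‖deriv (bergmanProjection ω f) z‖ₑ ≤ growthNorm (tail ν) f *
      ∫⁻ ζ, ‖kerDeriv ω (z * conj ζ)‖ₑ * ENNReal.ofReal (ω ‖ζ‖ / tail ν ‖ζ‖) ∂discArea := by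
  rw [(hasDerivAt_bergmanProjection hω hfi hz).deriv, ← lintegral_const_mul' _ _ hf.2.ne]
  refine (enorm_integral_le_lintegral_enorm _).trans (lintegral_mono_ae ?_)
  filter_upwards [ae_mem_unitDisc, ae_enorm_mul_weight_le hν hω f] with ζ hζ h
  have h1 : ‖conj ζ‖ₑ ≤ 1 := by
    rw [← ofReal_norm, RCLike.norm_conj]
    exact ENNReal.ofReal_le_one.2 (norm_mem_Ico hζ).2.le
  rw [enorm_mul, enorm_mul (kerDeriv ω _)]
  calc _ ≤ growthNorm (tail ν) f * ENNReal.ofReal (ω ‖ζ‖ / tail ν ‖ζ‖) *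
        (‖kerDeriv ω (z * conj ζ)‖ₑ * 1) := by gcongr
    _ = _ := by ring

lemma MomentCondition.projectionBounded (hν : IsRadialWeight ν) (hω : IsRadialWeight ω)
    (hD : UpperDoubling ω) (h : MomentCondition ω ν) : ProjectionBounded ω (tail ν) := by
  obtain ⟨C, hC⟩ := exists_kerDeriv_mean_le hν hω hD h
  have hint : ∀ f ∈ growthSpace (tail ν), Integrable (fun ζ => f ζ * (ω ‖ζ‖ : ℂ)) discArea :=
    fun f hf => integrable_mul_weight_of_mem_growthSpace hν hω
      (h.moment_quotient_ne_top hν hω zero_le_one) hf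
  have hbound : ∀ f ∈ growthSpace (tail ν),
      blochNorm (tail ν) (bergmanProjection ω f) ≤ C * growthNorm (tail ν) f := by
    refine fun f hf => iSup₂_le fun z hz => ?_
    calc _ ≤ ENNReal.ofReal ((1 - ‖z‖) * tail ν ‖z‖) * (growthNorm (tail ν) f *
          ∫⁻ ζ, ‖kerDeriv ω (z * conj ζ)‖ₑ * ENNReal.ofReal (ω ‖ζ‖ / tail ν ‖ζ‖) ∂discArea) := by
          gcongr
          exact enorm_deriv_bergmanProjection_le hν hω hf (hint f hf) hz
      _ ≤ C * growthNorm (tail ν) f := by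
          rw [mul_left_comm, mul_comm]
          gcongr
          exact hC z hz
  refine ⟨fun f hf => ⟨projectionDefined_of_integrable hω (hint f hf), ?_,
    (hbound f hf).trans_lt (ENNReal.mul_lt_top ENNReal.coe_lt_top hf.2)⟩, C, hbound⟩
  refine DifferentiableOn.analyticOnNhd (fun z hz => ?_) isOpen_unitDisc
  exact (hasDerivAt_bergmanProjection hω (hint f hf) hz).differentiableAt.differentiableWithinAt

end Bounded

/-! ### Boundedness implies the tail condition -/

/-- The function `ζ ↦ (ζ/|ζ|)^n / v(|ζ|)`. -/
noncomputable def angularTest (v : ℝ → ℝ) (n : ℕ) (ζ : ℂ) : ℂ :=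
  (ζ / (‖ζ‖ : ℂ)) ^ n * (((v ‖ζ‖)⁻¹ : ℝ) : ℂ)

lemma norm_div_norm_pow_le (ζ : ℂ) (n : ℕ) : ‖(ζ / (‖ζ‖ : ℂ)) ^ n‖ ≤ 1 := by
  rw [norm_pow, norm_div, Complex.norm_real, norm_norm]
  exact pow_le_one₀ (by positivity) (div_self_le_one _)

section Necessity

variable {ν ω : ℝ → ℝ}

lemma aestronglyMeasurable_angularTest (hν : IsRadialWeight ν) (n : ℕ) :
    AEStronglyMeasurable (angularTest (tail ν) n) discArea :=
  (by fun_prop : Measurable fun ζ : ℂ => (ζ / (‖ζ‖ : ℂ)) ^ n).aestronglyMeasurable.mul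
    (aestronglyMeasurable_radial (g := fun r => (tail ν r)⁻¹) hν.aemeasurable_tail.inv)

lemma growthNorm_angularTest_le (hν : IsRadialWeight ν) (n : ℕ) :
    growthNorm (tail ν) (angularTest (tail ν) n) ≤ 1 := by
  refine essSup_le_of_ae_le _ ?_
  filter_upwards [ae_mem_unitDisc] with ζ hζ
  have ht := hν.tail_pos _ (norm_mem_Ico hζ)
  rw [← ofReal_norm, ← ENNReal.ofReal_mul (norm_nonneg _), ENNReal.ofReal_le_one,
    angularTest, norm_mul, Complex.norm_of_nonneg (by positivity), mul_assoc,
    inv_mul_cancel₀ ht.ne', mul_one]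
  exact norm_div_norm_pow_le ζ n

lemma angularTest_mem_growthSpace (hν : IsRadialWeight ν) (n : ℕ) :
    angularTest (tail ν) n ∈ growthSpace (tail ν) :=
  ⟨aestronglyMeasurable_angularTest hν n,
    (growthNorm_angularTest_le hν n).trans_lt ENNReal.one_lt_top⟩

lemma angularTest_mul_weight (n : ℕ) (ζ : ℂ) : angularTest (tail ν) n ζ * (ω ‖ζ‖ : ℂ) =
    (ζ / (‖ζ‖ : ℂ)) ^ n * ((ω ‖ζ‖ / tail ν ‖ζ‖ : ℝ) : ℂ) := by
  rw [angularTest]; push_cast; ring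

lemma kerFun_zero (ω : ℝ → ℝ) : kerFun ω 0 = kerCoeff ω 0 := by
  rw [kerFun, tsum_eq_single 0 fun n hn => by simp [hn]]
  simp

/-- At z = 0 the kernel is the nonzero constant 1/(2ω₁), so absolute convergence there already says
that fω is integrable. -/
lemma ProjectionDefined.integrable (hω : IsRadialWeight ω) {f : ℂ → ℂ}
    (h : ProjectionDefined ω f) : Integrable (fun ζ => f ζ * (ω ‖ζ‖ : ℂ)) discArea := by
  have h0 : (0 : ℂ) ∈ unitDisc := by simp [unitDisc]
  have h1 := (integrable_congr (bergmanProjection_eq hω f h0)).1 (h 0 h0)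
  simp only [zero_mul, kerFun_zero] at h1
  have hk : (kerCoeff ω 0 : ℂ) ≠ 0 := by
    have := kerCoeff_mul hω 0
    exact_mod_cast left_ne_zero_of_mul (this.trans_ne one_ne_zero)
  simpa [hk] using h1.mul_const (kerCoeff ω 0 : ℂ)⁻¹

lemma ProjectionBounded.moment_quotient_ne_top (hν : IsRadialWeight ν) (hω : IsRadialWeight ω)
    (h : ProjectionBounded ω (tail ν)) : moment (fun s => ω s / tail ν s) 1 ≠ ∞ := by
  have h1 := ((h.1 _ (angularTest_mem_growthSpace hν 0)).1.integrable hω).2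
  simp only [angularTest_mul_weight, pow_zero, one_mul] at h1
  rw [hasFiniteIntegral_iff_enorm, lintegral_congr_ae (ae_mem_unitDisc.mono fun z hz =>
    enorm_ofReal_radial (g := fun s => ω s / tail ν s) (quotient_nonneg hν hω) hz),
    lintegral_ofReal_radial (aemeasurable_quotient hν hω)] at h1
  exact (ENNReal.lt_top_of_mul_ne_top_right h1.ne two_ne_zero).ne

/-- The moment of order 1 loses control near 0 only, and there ν̂ is at least ν̂(1/2), so that
integrability of ω suffices. -/
lemma lintegral_quotient_ne_top (hν : IsRadialWeight ν) (hω : IsRadialWeight ω)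
    (h : moment (fun s => ω s / tail ν s) 1 ≠ ∞) :
    ∫⁻ s in Ico (0 : ℝ) 1, ENNReal.ofReal (ω s / tail ν s) ≠ ∞ := by
  have hhalf : (1 / 2 : ℝ) ∈ Ico (0 : ℝ) 1 := by norm_num
  have ht := hν.tail_pos _ hhalf
  have hle : ∫⁻ s in Ico (0 : ℝ) 1, ENNReal.ofReal (ω s / tail ν s) ≤
      ∫⁻ s in Ico (0 : ℝ) 1, (ENNReal.ofReal (tail ν (1 / 2))⁻¹ * ENNReal.ofReal (ω s) +
        2 * ENNReal.ofReal (s ^ (1 : ℝ) * (ω s / tail ν s))) := by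
    refine setLIntegral_mono_ae' measurableSet_Ico (ae_of_all _ fun s hs => ?_)
    have hs1 := hν.tail_pos s hs
    have hs2 := hω.nonneg s hs
    rcases le_total s (1 / 2) with h1 | h1
    · refine le_add_of_le_of_nonneg ?_ zero_le
      rw [← ENNReal.ofReal_mul (by positivity), div_eq_inv_mul]
      refine ENNReal.ofReal_le_ofReal (mul_le_mul_of_nonneg_right ?_ hs2)
      exact inv_anti₀ ht (hν.tail_anti hs hhalf h1)
    · refine le_add_of_nonneg_of_le zero_le ?_
      rw [← ENNReal.ofReal_ofNat, ← ENNReal.ofReal_mul zero_le_two, Real.rpow_one, ← mul_assoc]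
      refine ENNReal.ofReal_le_ofReal (le_mul_of_one_le_left (by positivity) (by linarith))
  refine ne_top_of_le_ne_top ?_ hle
  rw [lintegral_add_left' (hω.aemeasurable.ennreal_ofReal.const_mul _),
    lintegral_const_mul' _ _ ENNReal.ofReal_ne_top, lintegral_const_mul' _ _ (by norm_num)]
  refine ENNReal.add_ne_top.2 ⟨ENNReal.mul_ne_top ENNReal.ofReal_ne_top ?_,
    ENNReal.mul_ne_top (by norm_num) h⟩
  exact hω.integrableOn.lintegral_lt_top.ne

/-- The test function has pure frequency n and modulus 1/ν̂ off the origin; the circular mean is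
therefore r^n instead of r^{2n}, and the area element raises the order of the moment to n + 1. -/
lemma integral_angularTest_mul_conj_pow (hν : IsRadialWeight ν) (hω : IsRadialWeight ω)
    (n k : ℕ)
    (hi : Integrable (fun ζ => angularTest (tail ν) n ζ * (ω ‖ζ‖ : ℂ)) discArea) :
    ∫ ζ, angularTest (tail ν) n ζ * (ω ‖ζ‖ : ℂ) * conj ζ ^ k ∂discArea =
      if k = n then 2 * ((moment (fun s => ω s / tail ν s) (n + 1)).toReal : ℂ) else 0 := by
  set g : ℝ → ℝ := fun s => ω s / tail ν s with hg
  have e1 : ∀ ζ : ℂ, angularTest (tail ν) n ζ * (ω ‖ζ‖ : ℂ) * conj ζ ^ k =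
      (ζ / (‖ζ‖ : ℂ)) ^ n * conj ζ ^ k * (g ‖ζ‖ : ℂ) := fun ζ => by
    rw [angularTest_mul_weight]; ring
  have hint : Integrable (fun ζ => (ζ / (‖ζ‖ : ℂ)) ^ n * conj ζ ^ k * (g ‖ζ‖ : ℂ)) discArea := by
    simp_rw [← e1]
    refine hi.norm.mono' (hi.1.mul (by fun_prop : Continuous _).aestronglyMeasurable) ?_
    filter_upwards [ae_mem_unitDisc] with ζ hζ
    rw [norm_mul, norm_pow, RCLike.norm_conj]
    exact mul_le_of_le_one_right (norm_nonneg _)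
      (pow_le_one₀ (norm_nonneg _) (norm_mem_Ico hζ).2.le)
  simp_rw [e1]
  rw [integral_mul_radial hint (c := fun r => if n = k then (r : ℂ) ^ n else 0) fun r hr => ?_]
  · rcases eq_or_ne k n with rfl | hnk
    · have e2 : ∀ r : ℝ, 2 * (r : ℂ) * (r : ℂ) ^ k * (g r : ℂ) =
          2 * ((r ^ (k + 1) * g r : ℝ) : ℂ) := fun r => by push_cast; ring
      simp only [if_true, e2]
      rw [integral_const_mul, integral_complex_ofReal,
        integral_pow_mul_eq_moment (aemeasurable_quotient hν hω) (quotient_nonneg hν hω)]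
      push_cast; rfl
    · simp [hnk, hnk.symm]
  · have hr0 : (r : ℂ) ≠ 0 := by exact_mod_cast hr.1.ne'
    simp only [norm_polarPoint hr.1.le, div_pow, div_mul_eq_mul_div]
    rw [intervalIntegral.integral_div, integral_polarPoint_pow_mul_conj_pow]
    rcases eq_or_ne n k with rfl | hnk
    · simp only [if_true]
      field_simp; ring
    · simp [hnk]

lemma bergmanProjection_angularTest (hν : IsRadialWeight ν) (hω : IsRadialWeight ω) (n : ℕ)
    (hi : Integrable (fun ζ => angularTest (tail ν) n ζ * (ω ‖ζ‖ : ℂ)) discArea) {z : ℂ}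
    (hz : z ∈ unitDisc) :
    bergmanProjection ω (angularTest (tail ν) n) z =
      (kerCoeff ω n * (2 * (moment (fun s => ω s / tail ν s) (n + 1)).toReal) : ℝ) * z ^ n := by
  rw [bergmanProjection, integral_congr_ae (bergmanProjection_eq hω _ hz)]
  refine (hasSum_integral_mul_kerFun hω hi hz).unique ?_
  simp_rw [integral_angularTest_mul_conj_pow hν hω n _ hi]
  convert hasSum_single n fun k hk => ?_ using 1
  · simp; ring
  · simp [hk]

lemma ProjectionBounded.exists_mul_moment_le (hν : IsRadialWeight ν) (hω : IsRadialWeight ω)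
    (h : ProjectionBounded ω (tail ν)) :
    ∃ C : ℝ≥0, ∀ n : ℕ, ∀ r ∈ Ico (0 : ℝ) 1,
      ENNReal.ofReal ((1 - r) * tail ν r) * ENNReal.ofReal (n * r ^ (n - 1)) *
        moment (fun s => ω s / tail ν s) (n + 1) ≤ C * moment ω (2 * n + 1) := by
  have hg1 := h.moment_quotient_ne_top hν hω
  obtain ⟨hdef, C, hC⟩ := h
  refine ⟨C, fun n r hr => ?_⟩
  have hi := integrable_mul_weight_of_mem_growthSpace hν hω hg1 (angularTest_mem_growthSpace hν n)
  have hz : (r : ℂ) ∈ unitDisc := by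
    simpa [unitDisc, abs_of_nonneg hr.1] using hr.2
  have hnorm : ‖(r : ℂ)‖ = r := Complex.norm_of_nonneg hr.1
  set G := moment (fun s => ω s / tail ν s) (n + 1) with hG
  have hGt : G ≠ ∞ := ne_top_of_le_ne_top hg1
    (moment_anti _ (quotient_nonneg hν hω) zero_le_one (by simp))
  have hmt : moment ω (2 * n + 1) ≠ ∞ := hω.moment_ne_top (by positivity)
  have hderiv : deriv (bergmanProjection ω (angularTest (tail ν) n)) r =
      ((kerCoeff ω n * (2 * G.toReal) * (n * r ^ (n - 1)) : ℝ) : ℂ) := by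
    have h1 : HasDerivAt (fun z : ℂ => ((kerCoeff ω n * (2 * G.toReal) : ℝ) : ℂ) * z ^ n)
        (((kerCoeff ω n * (2 * G.toReal) : ℝ) : ℂ) * (n * (r : ℂ) ^ (n - 1))) r :=
      (hasDerivAt_pow n (r : ℂ)).const_mul _
    rw [(h1.congr_of_eventuallyEq (f₁ := bergmanProjection ω (angularTest (tail ν) n)) ?_).deriv]
    · push_cast; ring
    · filter_upwards [isOpen_unitDisc.mem_nhds hz] with w hw
      exact bergmanProjection_angularTest hν hω n hi hw
  have hk := kerCoeff_nonneg ω n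
  have hr0 := hr.1
  have hb : ENNReal.ofReal ((1 - r) * tail ν r) *
      ENNReal.ofReal (kerCoeff ω n * (2 * G.toReal) * (n * r ^ (n - 1))) ≤ C := by
    have h1 := le_iSup₂ (f := fun (z : ℂ) (_ : z ∈ unitDisc) =>
      ENNReal.ofReal ((1 - ‖z‖) * tail ν ‖z‖) *
        ‖deriv (bergmanProjection ω (angularTest (tail ν) n)) z‖ₑ) (r : ℂ) hz
    rw [hnorm, hderiv, ← ofReal_norm, Complex.norm_of_nonneg (by positivity)] at h1
    calc _ ≤ C * growthNorm (tail ν) (angularTest (tail ν) n) :=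
          h1.trans (hC _ (angularTest_mem_growthSpace hν n))
      _ ≤ C * 1 := by gcongr; exact growthNorm_angularTest_le hν n
      _ = C := mul_one _
  have e1 : ENNReal.ofReal (n * r ^ (n - 1)) * G =
      ENNReal.ofReal (kerCoeff ω n * (2 * G.toReal) * (n * r ^ (n - 1))) *
        moment ω (2 * n + 1) := by
    have h1 := kerCoeff_mul hω n
    rw [← ENNReal.ofReal_toReal hGt, ← ENNReal.ofReal_toReal hmt,
      ← ENNReal.ofReal_mul (by positivity), ← ENNReal.ofReal_mul (by positivity),
      ENNReal.toReal_ofReal ENNReal.toReal_nonneg]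
    congr 1
    linear_combination -(n * r ^ (n - 1) * G.toReal) * h1
  rw [mul_assoc, e1, ← mul_assoc]
  gcongr

lemma one_quarter_le_pow {r : ℝ} (hr : 1 / 2 ≤ r) (hr1 : r < 1) {n : ℕ}
    (hn : (n : ℝ) ≤ 1 / (1 - r)) : 1 / 4 ≤ r ^ n := by
  have h0 : 0 < 1 - r := by linarith
  have hy : 2 ≤ 1 / (1 - r) := by rw [le_div_iff₀ h0]; linarith
  -- Bernoulli's inequality; its exponent 1/(2(1-r)) is at least 1 because r ≥ 1/2.
  have h1 : (1 / 2 : ℝ) ≤ r ^ (1 / (1 - r) / 2) := by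
    calc (1 / 2 : ℝ) = 1 + 1 / (1 - r) / 2 * (r - 1) := by field_simp; ring
      _ ≤ (1 + (r - 1)) ^ (1 / (1 - r) / 2) :=
          one_add_mul_self_le_rpow_one_add (by linarith) (by linarith)
      _ = _ := by ring_nf
  calc (1 / 4 : ℝ) = (1 / 2) ^ 2 := by norm_num
    _ ≤ (r ^ (1 / (1 - r) / 2)) ^ 2 := by gcongr
    _ = r ^ (1 / (1 - r)) := by
        rw [← Real.rpow_natCast, ← Real.rpow_mul (by linarith)]; push_cast; ring_nf
    _ ≤ r ^ (n : ℝ) := Real.rpow_le_rpow_of_exponent_ge (by linarith) hr1.le hn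
    _ = r ^ n := Real.rpow_natCast _ _

lemma ProjectionBounded.exists_tail_mul_le (hν : IsRadialWeight ν) (hω : IsRadialWeight ω)
    (hD : UpperDoubling ω) (h : ProjectionBounded ω (tail ν)) :
    ∃ C : ℝ≥0, ∀ r : ℝ, 1 / 2 ≤ r → r < 1 → ENNReal.ofReal (tail ν r) *
      (∫⁻ s in Ico r 1, ENNReal.ofReal (ω s / tail ν s)) ≤ C * ENNReal.ofReal (tail ω r) := by
  obtain ⟨C, hC⟩ := h.exists_mul_moment_le hν hω
  obtain ⟨D, hD⟩ := hω.exists_tailDoubling hD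
  obtain ⟨K, hK⟩ := exists_lintegral_rpow_le (ae_mem_radialMeasure ω) hD
  refine ⟨64 * C * K, fun r hr hr1 => ?_⟩
  have hrm : r ∈ Ico (0 : ℝ) 1 := ⟨by linarith, hr1⟩
  have hr0 := hrm.1
  have h0 : 0 < 1 - r := by linarith
  have ht := hν.tail_pos r hrm
  set g : ℝ → ℝ := fun s => ω s / tail ν s with hg
  -- At this frequency n(1-r) ≥ 1 absorbs the factor 1 - r of the Bloch norm, while r^{n-1} ≥ 1/4
  -- and r^{n+1} ≥ 1/16 stay bounded below; the constant 64 below is 4 · 16.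
  set n : ℕ := ⌈1 / (1 - r)⌉₊ with hn
  have hn1 : 1 / (1 - r) ≤ n := Nat.le_ceil _
  have hn0 : 0 < n := Nat.ceil_pos.2 (by positivity)
  have hn2 : ((n - 1 : ℕ) : ℝ) ≤ 1 / (1 - r) := by
    have := Nat.ceil_lt_add_one (by positivity : 0 ≤ 1 / (1 - r))
    rw [Nat.cast_sub hn0]; push_cast; linarith
  have hn3 : 1 ≤ n * (1 - r) := by rwa [div_le_iff₀ h0] at hn1
  have hpow := one_quarter_le_pow hr hr1 hn2
  have hpow2 : 1 / 16 ≤ r ^ (n + 1) := by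
    calc (1 / 16 : ℝ) = 1 / 4 * (1 / 2) ^ 2 := by norm_num
      _ ≤ r ^ (n - 1) * r ^ 2 := by gcongr
      _ = r ^ (n + 1) := by rw [← pow_add]; congr 1; omega
  have hW : ENNReal.ofReal (1 / 16) * (∫⁻ s in Ico r 1, ENNReal.ofReal (g s)) ≤
      moment g (n + 1) := by
    have h1 := ofReal_rpow_mul_le_moment (aemeasurable_quotient hν hω) hr0
      (by positivity : (0 : ℝ) ≤ n + 1)
    rw [radialMeasure_Ici _ hr0] at h1
    refine le_trans (mul_le_mul_left (ENNReal.ofReal_le_ofReal (hpow2.trans_eq ?_)) _) h1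
    rw [← Real.rpow_natCast]; push_cast; rfl
  have hM : moment ω (2 * n + 1) ≤ K * ENNReal.ofReal (tail ω r) := by
    have h1 := hK (2 * n + 1) (by positivity)
    rw [lintegral_radialMeasure hω.aemeasurable] at h1
    refine h1.trans (mul_le_mul_right ?_ _)
    rw [hω.ofReal_tail hrm]
    refine (tailMass_mono _ (?_ : _ ≤ 1 - r)).trans_eq (by rw [tailMass, sub_sub_cancel])
    rw [div_le_iff₀ (by positivity)]
    nlinarith
  have hν' : ENNReal.ofReal (tail ν r) ≤ 4 * (ENNReal.ofReal ((1 - r) * tail ν r) *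
      ENNReal.ofReal (n * r ^ (n - 1))) := by
    rw [← ENNReal.ofReal_mul (by positivity), ← ENNReal.ofReal_ofNat,
      ← ENNReal.ofReal_mul (by norm_num)]
    refine ENNReal.ofReal_le_ofReal ?_
    calc tail ν r = 4 * (1 * tail ν r * (1 / 4)) := by ring
      _ ≤ 4 * ((n * (1 - r)) * tail ν r * r ^ (n - 1)) := by gcongr
      _ = _ := by ring
  have h16 : (∫⁻ s in Ico r 1, ENNReal.ofReal (g s)) =
      16 * (ENNReal.ofReal (1 / 16) * ∫⁻ s in Ico r 1, ENNReal.ofReal (g s)) := by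
    rw [← mul_assoc, ← ENNReal.ofReal_ofNat, ← ENNReal.ofReal_mul (by norm_num)]
    norm_num
  calc ENNReal.ofReal (tail ν r) * ∫⁻ s in Ico r 1, ENNReal.ofReal (g s)
      ≤ (4 * (ENNReal.ofReal ((1 - r) * tail ν r) * ENNReal.ofReal (n * r ^ (n - 1)))) *
          (16 * moment g (n + 1)) := by
        refine mul_le_mul' hν' ?_
        rw [h16]
        gcongr
    _ = 64 * (ENNReal.ofReal ((1 - r) * tail ν r) * ENNReal.ofReal (n * r ^ (n - 1)) *
          moment g (n + 1)) := by ring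
    _ ≤ 64 * (C * (K * ENNReal.ofReal (tail ω r))) :=
        mul_le_mul_right ((hC n r hrm).trans (mul_le_mul_right hM _)) _
    _ = _ := by push_cast; ring

lemma ProjectionBounded.tailCondition (hν : IsRadialWeight ν) (hω : IsRadialWeight ω)
    (hD : UpperDoubling ω) (h : ProjectionBounded ω (tail ν)) : TailCondition ω ν := by
  obtain ⟨C, hC⟩ := h.exists_tail_mul_le hν hω hD
  have hfin := lintegral_quotient_ne_top hν hω (h.moment_quotient_ne_top hν hω)
  have hzero : (0 : ℝ) ∈ Ico (0 : ℝ) 1 := by norm_num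
  have hhalf : (1 / 2 : ℝ) ∈ Ico (0 : ℝ) 1 := by norm_num
  have ht := hω.tail_pos _ hhalf
  -- For r ≤ 1/2 monotonicity of the tails bounds the whole expression by this one finite quantity.
  set B : ℝ≥0∞ := ENNReal.ofReal (tail ν 0 / tail ω (1 / 2)) *
    ∫⁻ s in Ico (0 : ℝ) 1, ENNReal.ofReal (ω s / tail ν s)
  have hB : B ≠ ∞ := ENNReal.mul_ne_top ENNReal.ofReal_ne_top hfin
  refine lt_of_le_of_lt (b := C + B) (iSup₂_le fun r hr => ?_)
    (ENNReal.add_lt_top.2 ⟨ENNReal.coe_lt_top, hB.lt_top⟩)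
  have hr1 := hω.tail_pos r hr
  rcases le_total (1 / 2) r with h1 | h1
  · refine le_trans ?_ le_self_add
    rw [ENNReal.ofReal_div_of_pos hr1, ← ENNReal.mul_div_right_comm]
    exact ENNReal.div_le_of_le_mul (hC r h1 hr.2)
  · refine le_trans ?_ le_add_self
    refine mul_le_mul' (ENNReal.ofReal_le_ofReal ?_)
      (lintegral_mono_set (Ico_subset_Ico_left hr.1))
    exact div_le_div₀ (hν.tail_pos 0 hzero).le (hν.tail_anti hzero hr hr.1) ht
      (hω.tail_anti hr hhalf h1)

end Necessity

end BergmanGrowth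

theorem mainTheorem4 (ν ω : ℝ → ℝ)
    (hν : BergmanGrowth.IsRadialWeight ν) (hω : BergmanGrowth.IsRadialWeight ω)
    (hωD : BergmanGrowth.UpperDoubling ω) :
    List.TFAE
      [BergmanGrowth.ProjectionBounded ω (BergmanGrowth.tail ν),
       BergmanGrowth.MomentCondition ω ν,
       BergmanGrowth.TailCondition ω ν] := by
  tfae_have 1 → 3 := BergmanGrowth.ProjectionBounded.tailCondition hν hω hωD
  tfae_have 3 → 2 := BergmanGrowth.TailCondition.momentCondition hν hω hωD
  tfae_have 2 → 1 := BergmanGrowth.MomentCondition.projectionBounded hν hω hωD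
  tfae_finish
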